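/- Let $k$ be a field, let $q\in k$ be nonzero and not a root of unity, and let $a,b\ge 2$ be integers. Let $$A=k\langle X,Y\rangle/(X^a,\;XY-qYX,\;Y^b),$$ where $k\langle X,Y\rangle$ is the free associative algebra on $X,Y$. Let $A^{e}=A\otimes_k A^{\mathrm{op}}$, and let $\mathrm{HH}_n(A)=\mathrm{Tor}_n^{A^{e}}(A,A)$ denote the $n$-th Hochschild homology of $A$. Then $\dim_k \mathrm{HH}_0(A)=a+b-1$, and for every $n\ge 1$ $$\dim_k \mathrm{HH}_n(A)=\begin{cases} a+b & \text{if } \operatorname{char}k \text{ divides both } a \text{ and } b,\\ a+b-1 & \text{if } \operatorname{char}k \text{ divides exactly one of } a \text{ and } b,\\ a+b-2 & \text{if } \operatorname{char}k \text{ divides neither } a \text{ nor } b.\end{cases}$$ In particular, $\mathrm{HH}_n(A)\ne 0$ for every $n\ge 0$. -/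

import Mathlib

open CategoryTheory TensorProduct MulOpposite

open scoped ModuleCat

universe u

noncomputable section

namespace HochschildQCI

/-! ### Tensor products and `Tor` over a noncommutative algebra -/

section Tor

variable (k : Type u) [Field k] (R : Type u) [Ring R] [Algebra k R]
variable (B : Type u) [AddCommGroup B] [Module k B] [Module Rᵐᵒᵖ B] [IsScalarTower k Rᵐᵒᵖ B]

/-- The subspace of `B ⊗[k] N` spanned by the elements `(b · r) ⊗ n - b ⊗ (r · n)`, where `B` is a
right and `N` a left module over the `k`-algebra `R`. -/
def balancedRel (N : Type u) [AddCommGroup N] [Module k N] [Module R N] [IsScalarTower k R N] :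
    Submodule k (B ⊗[k] N) :=
  Submodule.span k
    {z | ∃ (b : B) (r : R) (n : N), z = (op r • b) ⊗ₜ[k] n - b ⊗ₜ[k] (r • n)}

/-- The functor `B ⊗_R -` from left `R`-modules to `k`-vector spaces, for a right module `B` over a
`k`-algebra `R` (right modules are modules over `Rᵐᵒᵖ`). -/
def tensorFunctor : ModuleCat.{u} R ⥤ ModuleCat.{u} k where
  obj N := ModuleCat.of k ((B ⊗[k] N) ⧸ balancedRel k R B N)
  map {M N} f := ModuleCat.ofHom <|
    Submodule.mapQ (balancedRel k R B M) (balancedRel k R B N)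
      (LinearMap.lTensor B (f.hom.restrictScalars k)) (by
        rw [balancedRel, Submodule.span_le]
        rintro _ ⟨b, r, n, rfl⟩
        refine Submodule.subset_span ⟨b, r, f.hom n, ?_⟩
        simp)
  map_id M := ModuleCat.hom_ext <|
    Submodule.linearMap_qext _ <| TensorProduct.ext' fun _ _ => rfl
  map_comp f g := ModuleCat.hom_ext <|
    Submodule.linearMap_qext _ <| TensorProduct.ext' fun _ _ => rfl

instance tensorFunctor_additive : (tensorFunctor k R B).Additive where
  map_add {_ _ f g} := ModuleCat.hom_ext <|
    Submodule.linearMap_qext _ <| TensorProduct.ext' fun b n =>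
      congrArg Submodule.Quotient.mk (TensorProduct.tmul_add b (f.hom n) (g.hom n))

/-- `Tor_n^R(B, N)`, the `n`-th left derived functor of `B ⊗_R -` at `N`, as a `k`-vector space. -/
def tor (n : ℕ) (N : ModuleCat.{u} R) : ModuleCat.{u} k :=
  ((tensorFunctor k R B).leftDerived n).obj N

end Tor

/-! ### Hochschild homology -/

section Hochschild

variable (k : Type u) [Field k] (A : Type u) [Ring A] [Algebra k A]

/-- The enveloping algebra `A ⊗ Aᵒᵖ`. -/
abbrev Enveloping : Type u := A ⊗[k] Aᵐᵒᵖ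

/-- The isomorphism of the opposite of the enveloping algebra with the enveloping algebra that
exchanges the two factors. -/
def envelopingSwap : (Enveloping k A)ᵐᵒᵖ ≃ₐ[k] Enveloping k A :=
  ((Algebra.TensorProduct.opAlgEquiv k k A Aᵐᵒᵖ).symm.trans
    (Algebra.TensorProduct.congr AlgEquiv.refl (AlgEquiv.opOp k A).symm)).trans
      (Algebra.TensorProduct.comm k Aᵐᵒᵖ A)

theorem envelopingSwap_tmul (w₁ w₂ : A) :
    envelopingSwap k A (op (w₁ ⊗ₜ[k] op w₂)) = w₂ ⊗ₜ[k] op w₁ := by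
  simp [envelopingSwap]

/-- `A` as a left module over its enveloping algebra: `(w₁ ⊗ w₂) · u = w₁ u w₂`. -/
abbrev leftEnvelopingModule : Module (Enveloping k A) A :=
  Module.compHom A (AlgHom.mulLeftRight k A).toRingHom

theorem leftEnvelopingModule_smul (w₁ w₂ u : A) :
    letI := leftEnvelopingModule k A
    (w₁ ⊗ₜ[k] op w₂ : Enveloping k A) • u = w₁ * u * w₂ :=
  AlgHom.mulLeftRight_apply k A w₁ (op w₂) u

/-- `A` as a right module over its enveloping algebra: `u · (w₁ ⊗ w₂) = w₂ u w₁`. -/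
abbrev rightEnvelopingModule : Module (Enveloping k A)ᵐᵒᵖ A :=
  Module.compHom A
    ((AlgHom.mulLeftRight k A).comp (envelopingSwap k A).toAlgHom).toRingHom

theorem rightEnvelopingModule_smul (w₁ w₂ u : A) :
    letI := rightEnvelopingModule k A
    op (w₁ ⊗ₜ[k] op w₂ : Enveloping k A) • u = w₂ * u * w₁ := by
  change AlgHom.mulLeftRight k A (envelopingSwap k A (op (w₁ ⊗ₜ[k] op w₂))) u = _
  rw [envelopingSwap_tmul, AlgHom.mulLeftRight_apply, unop_op]

theorem rightEnvelopingModule_isScalarTower :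
    letI := rightEnvelopingModule k A
    IsScalarTower k (Enveloping k A)ᵐᵒᵖ A :=
  letI := rightEnvelopingModule k A
  ⟨fun c r u => by
    change ((AlgHom.mulLeftRight k A).comp (envelopingSwap k A).toAlgHom) (c • r) u =
      c • ((AlgHom.mulLeftRight k A).comp (envelopingSwap k A).toAlgHom) r u
    rw [map_smul, LinearMap.smul_apply]⟩

/-- The Hochschild homology `HH_n(A) = Tor_n^{A ⊗ Aᵒᵖ}(A, A)` of a `k`-algebra `A`. -/
def hochschildHomology (n : ℕ) : ModuleCat.{u} k :=
  letI := leftEnvelopingModule k A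
  letI := rightEnvelopingModule k A
  haveI := rightEnvelopingModule_isScalarTower k A
  tor k (Enveloping k A) A n (ModuleCat.of (Enveloping k A) A)

end Hochschild

/-! ### Quantum complete intersections of codimension two -/

section QuantumCompleteIntersection

variable {k : Type u} [Field k]

/-- The defining relations `X ^ a = 0`, `X Y = q Y X`, `Y ^ b = 0` on the free algebra in the two
generators `X = ι 0` and `Y = ι 1`. -/
inductive QCIRel (q : k) (a b : ℕ) : FreeAlgebra k (Fin 2) → FreeAlgebra k (Fin 2) → Prop
  | x_pow : QCIRel q a b (FreeAlgebra.ι k 0 ^ a) 0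
  | comm : QCIRel q a b (FreeAlgebra.ι k 0 * FreeAlgebra.ι k 1)
      (q • (FreeAlgebra.ι k 1 * FreeAlgebra.ι k 0))
  | y_pow : QCIRel q a b (FreeAlgebra.ι k 1 ^ b) 0

/-- The algebra `k⟨X, Y⟩ / (X ^ a, X Y - q Y X, Y ^ b)`. -/
abbrev QuantumCI (q : k) (a b : ℕ) : Type u := RingQuot (QCIRel q a b)

end QuantumCompleteIntersection

end HochschildQCI

end

open CategoryTheory TensorProduct MulOpposite

open scoped ModuleCat

noncomputable section

namespace HochschildQCI

/-! The algebra `A` has the monomials `Y ^ v * X ^ u` (`v < b`, `u < a`) as a basis and is a twisted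
tensor product of `k[x] / (x ^ a)` and `k[y] / (y ^ b)`. Each factor has a 2-periodic bimodule
resolution, with differentials alternately `x ⊗ 1 - 1 ⊗ x` and `∑ x ^ t ⊗ x ^ (a - 1 - t)`. Their
tensor product, with powers of `q` inserted whenever an `X` passes a `Y`, resolves `A` over its
enveloping algebra, with one free generator at each position `(i, j)`. This step needs only `q ≠ 0`.

Tensoring with `A` puts a copy of `A` at each position, and the differentials send monomials to
multiples of monomials (`homX_monomial`, `homY_monomial`). The scalar in the `X`-direction is `1 -
Q` or `1 + Q + ⋯ + Q ^ (a - 1)` with `Q = q ^ m`, where `m` is the total `Y`-degree of generator and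
monomial. As `q` is not a root of unity, this is invertible for `m > 0` (`scalarX_pow_eq_zero_iff`),
and `m = 0` means `j = 0` and `v = 0`. So the strands with `m > 0` are exact in the `X`-direction
except at `i = 0`, where the powers of `Y` remain and form the Hochschild complex of `k[y] / (y ^
b)`. What is left is the homology of `k[x] / (x ^ a)` on the axis `j = 0` and that of `k[y] / (y ^
b)` on the axis `i = 0`, with the class of `1` shared in degree `0`. In positive degree the first
has dimension `a` if `a = 0` in `k` and `a - 1` otherwise; likewise the second with `b`.

Exactness of the resolution and the computation of the homology both come from one explicit homotopy
formula `D H + H D + P = 1` on a total complex (`totalD_totalH`). For the resolution, `P` factors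
through the augmentation; for the Hochschild complex, `P` projects to the surviving monomials, and
`rank_homology_eq_rank_range` turns this into a count. -/

/-! ### Homology of short complexes up to homotopy -/

section Homology

variable {k : Type u} [Field k]

/-- If `f s + t g = 1 - p` for an idempotent `p` with `p f = 0` and `g p = 0`, then the homology of
`f, g` is the range of `p`. -/
theorem rank_homology_eq_rank_range (S : ShortComplex (ModuleCat.{u} k)) {W₁ W₂ W₃ : Type u}
    [AddCommGroup W₁] [Module k W₁] [AddCommGroup W₂] [Module k W₂] [AddCommGroup W₃] [Module k W₃]
    (e₁ : S.X₁ ≃ₗ[k] W₁) (e₂ : S.X₂ ≃ₗ[k] W₂) (e₃ : S.X₃ ≃ₗ[k] W₃)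
    (f : W₁ →ₗ[k] W₂) (g : W₂ →ₗ[k] W₃)
    (hf : ∀ x, e₂ (S.f.hom x) = f (e₁ x)) (hg : ∀ x, e₃ (S.g.hom x) = g (e₂ x))
    (s : W₂ →ₗ[k] W₁) (t : W₃ →ₗ[k] W₂) (p : W₂ →ₗ[k] W₂)
    (h : ∀ x, f (s x) + t (g x) + p x = x) (hpp : ∀ x, p (p x) = p x) (hpf : ∀ x, p (f x) = 0)
    (hgp : ∀ x, g (p x) = 0) :
    Module.rank k S.homology = Module.rank k (LinearMap.range p) := by
  rw [(S.moduleCatHomologyIso.toLinearEquiv).rank_eq]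
  -- On cycles the identity reads `x = f (s x) + p x`, so a cycle killed by `p` is a boundary.
  let π : LinearMap.ker S.g.hom →ₗ[k] LinearMap.range p :=
    p.rangeRestrict ∘ₗ e₂.toLinearMap ∘ₗ (LinearMap.ker S.g.hom).subtype
  have hker : LinearMap.ker π = LinearMap.range S.moduleCatToCycles := by
    ext x
    constructor
    · intro hx
      have hx' : p (e₂ x) = 0 := congrArg Subtype.val hx
      have hgx : g (e₂ x) = 0 := by rw [← hg, x.2, map_zero]
      have := h (e₂ x)
      rw [hgx, hx', map_zero, add_zero, add_zero] at this
      refine ⟨e₁.symm (s (e₂ x)), Subtype.ext (e₂.injective ?_)⟩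
      change e₂ (S.f.hom _) = _
      rw [hf, LinearEquiv.apply_symm_apply, this]
    · rintro ⟨y, rfl⟩
      refine Subtype.ext ?_
      change p (e₂ (S.f.hom y)) = 0
      rw [hf, hpf]
  have hsurj : Function.Surjective π := by
    rintro ⟨_, w, rfl⟩
    refine ⟨⟨e₂.symm (p w), e₃.injective ?_⟩, Subtype.ext ?_⟩
    · rw [hg, LinearEquiv.apply_symm_apply, hgp, map_zero]
    · change p (e₂ (e₂.symm (p w))) = p w
      rw [LinearEquiv.apply_symm_apply, hpp]
  exact ((Submodule.quotEquivOfEq _ _ hker.symm).trans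
    (π.quotKerEquivOfSurjective hsurj)).rank_eq

end Homology

/-! ### `Tor` from a resolution by free modules of finite rank -/

section FreeResolution

variable (k : Type u) [Field k] (R : Type u) [Ring R] [Algebra k R]
variable (B : Type u) [AddCommGroup B] [Module k B] [Module Rᵐᵒᵖ B] [IsScalarTower k Rᵐᵒᵖ B]

/-- For a free module `N` with basis indexed by `I`, the bilinear map `B × N → B^I` that sends
`b, ∑ i, r i • e i` to `i ↦ b · r i`. -/
def tensorFreeMap {N : Type u} [AddCommGroup N] [Module k N] [Module R N] [IsScalarTower k R N]
    {I : Type} (e : N ≃ₗ[R] (I → R)) : B ⊗[k] N →ₗ[k] (I → B) :=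
  TensorProduct.lift <| LinearMap.mk₂ k (fun b n i => op (e n i) • b)
    (fun b b' n => by ext i; simp)
    (fun c b n => by ext i; exact smul_algebra_smul_comm c (op (e n i)) b)
    (fun b n n' => by ext i; simp [add_smul])
    (fun c b n => by
      ext i
      rw [← algebraMap_smul R c n, map_smul]
      change op (algebraMap k R c * e n i) • b = c • (op (e n i) • b)
      rw [Algebra.commutes, op_mul, mul_smul, ← algebraMap_smul Rᵐᵒᵖ c]
      rfl)

@[simp]
theorem tensorFreeMap_tmul {N : Type u} [AddCommGroup N] [Module k N] [Module R N]
    [IsScalarTower k R N] {I : Type} (e : N ≃ₗ[R] (I → R)) (b : B) (n : N) (i : I) :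
    tensorFreeMap k R B e (b ⊗ₜ n) i = op (e n i) • b := rfl

theorem balancedRel_le_ker_tensorFreeMap {N : Type u} [AddCommGroup N] [Module k N] [Module R N]
    [IsScalarTower k R N] {I : Type} (e : N ≃ₗ[R] (I → R)) :
    balancedRel k R B N ≤ LinearMap.ker (tensorFreeMap k R B e) := by
  rw [balancedRel, Submodule.span_le]
  rintro _ ⟨b, r, n, rfl⟩
  simp only [SetLike.mem_coe, LinearMap.mem_ker, map_sub]
  rw [sub_eq_zero]
  ext i
  simp [mul_smul]

omit [IsScalarTower k Rᵐᵒᵖ B] in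
theorem mk_smul_tmul {N : Type u} [AddCommGroup N] [Module k N] [Module R N]
    [IsScalarTower k R N] (b : B) (r : R) (n : N) :
    (balancedRel k R B N).mkQ ((op r • b) ⊗ₜ n) = (balancedRel k R B N).mkQ (b ⊗ₜ (r • n)) := by
  rw [← sub_eq_zero, ← map_sub]
  exact (Submodule.Quotient.mk_eq_zero _).2 (Submodule.subset_span ⟨b, r, n, rfl⟩)

/-- The identification of `B ⊗_R N` with `B^I` for a free module `N` with basis indexed by `I`. -/
def tensorFreeEquiv {N : Type u} [AddCommGroup N] [Module k N] [Module R N] [IsScalarTower k R N]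
    {I : Type} [Fintype I] [DecidableEq I] (e : N ≃ₗ[R] (I → R)) :
    ((B ⊗[k] N) ⧸ balancedRel k R B N) ≃ₗ[k] (I → B) :=
  LinearEquiv.ofLinearMap
    (Submodule.liftQ _ (tensorFreeMap k R B e) (balancedRel_le_ker_tensorFreeMap k R B e))
    (∑ i, (balancedRel k R B N).mkQ ∘ₗ
      (TensorProduct.mk k B N).flip (e.symm (Pi.single i (1 : R))) ∘ₗ LinearMap.proj i)
    (by
      refine LinearMap.ext fun f => funext fun i => ?_
      simp only [LinearMap.comp_apply, LinearMap.sum_apply, map_sum, Finset.sum_apply,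
        Submodule.mkQ_apply, Submodule.liftQ_apply, LinearMap.flip_apply, TensorProduct.mk_apply,
        tensorFreeMap_tmul, LinearEquiv.apply_symm_apply, LinearMap.proj_apply, LinearMap.id_apply]
      rw [Finset.sum_eq_single i (fun j _ hj => by simp [Pi.single_eq_of_ne hj.symm]) (by simp)]
      simp)
    (by
      refine Submodule.linearMap_qext _ (TensorProduct.ext' fun b n => ?_)
      simp only [LinearMap.comp_apply, LinearMap.sum_apply, Submodule.mkQ_apply,
        Submodule.liftQ_apply, LinearMap.flip_apply, TensorProduct.mk_apply,
        tensorFreeMap_tmul, LinearMap.proj_apply, LinearMap.id_apply]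
      simp only [← Submodule.mkQ_apply, mk_smul_tmul]
      rw [← map_sum, ← TensorProduct.tmul_sum]
      congr 2
      apply e.injective
      simp only [map_sum, map_smul, LinearEquiv.apply_symm_apply]
      exact (pi_eq_sum_univ' (e n)).symm)

/-- `tensorFreeEquiv` for an object of the category of `R`-modules. -/
def tensorFunctorFreeEquiv {N : ModuleCat.{u} R} {I : Type} [Fintype I] [DecidableEq I]
    (e : N ≃ₗ[R] (I → R)) : (tensorFunctor k R B).obj N ≃ₗ[k] (I → B) :=
  tensorFreeEquiv k R B e

variable {R B} in
theorem tensorFunctorFreeEquiv_map {N N' : ModuleCat.{u} R} {I I' : Type} [Fintype I]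
    [DecidableEq I] [Fintype I'] [DecidableEq I'] (e : N ≃ₗ[R] (I → R)) (e' : N' ≃ₗ[R] (I' → R))
    (φ : N ⟶ N') (d : (I → B) →ₗ[k] (I' → B))
    (hd : ∀ (b : B) (n : N), d (fun i => op (e n i) • b) = fun i => op (e' (φ.hom n) i) • b)
    (x : (tensorFunctor k R B).obj N) :
    tensorFunctorFreeEquiv k R B e' (((tensorFunctor k R B).map φ).hom x) =
      d (tensorFunctorFreeEquiv k R B e x) := by
  let g₁ := (tensorFunctorFreeEquiv k R B e').toLinearMap ∘ₗ ((tensorFunctor k R B).map φ).hom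
  let g₂ := d ∘ₗ (tensorFunctorFreeEquiv k R B e).toLinearMap
  have : g₁ = g₂ := Submodule.linearMap_qext (balancedRel k R B N)
    (TensorProduct.ext' fun b n => (hd b n).symm)
  exact LinearMap.congr_fun this x

variable {R}
variable {I : ℕ → Type} [∀ n, Fintype (I n)] [∀ n, DecidableEq (I n)]
  (d : ∀ n, (I (n + 1) → R) →ₗ[R] (I n → R))
  (hd : ∀ n, Function.Exact (d (n + 1)) (d n))

/-- The chain complex of the free modules `R^(I n)` with the differentials `d n`. -/
def freeComplex : ChainComplex (ModuleCat.{u} R) ℕ :=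
  ChainComplex.of (fun n => ModuleCat.of R (I n → R)) (fun n => ModuleCat.ofHom (d n))
    (fun n => ModuleCat.hom_ext (LinearMap.ext fun x => (hd n).apply_apply_eq_zero x))

omit [∀ n, Fintype (I n)] [∀ n, DecidableEq (I n)] in
theorem freeComplex_d (n : ℕ) : (freeComplex d hd).d (n + 1) n = ModuleCat.ofHom (d n) :=
  ChainComplex.of_d (fun n => ModuleCat.of R (I n → R)) (fun n => ModuleCat.ofHom (d n)) n

variable (M : ModuleCat.{u} R) (ε : (I 0 → R) →ₗ[R] M) (hε : Function.Surjective ε)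
  (hdε : Function.Exact (d 0) ε)

/-- The projective resolution of `M` given by an exact sequence of free modules. -/
def freeResolution : ProjectiveResolution M where
  complex := freeComplex d hd
  projective n := by
    change Projective (ModuleCat.of R (I n → R))
    infer_instance
  π := ((freeComplex d hd).toSingle₀Equiv M).symm ⟨ModuleCat.ofHom ε, by
    rw [freeComplex_d]
    exact ModuleCat.hom_ext (LinearMap.ext fun x => hdε.apply_apply_eq_zero x)⟩
  quasiIso := ⟨fun n => by
    cases n with
    | zero =>
      -- In degree `0` the claim is exactness of `R^(I 1) → R^(I 0) → M → 0`; in positive degrees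
      -- the target has no homology and the claim is exactness of the complex itself.
      rw [ChainComplex.quasiIsoAt₀_iff, ShortComplex.quasiIso_iff_of_zeros']
      · have hE : (ShortComplex.mk (ModuleCat.ofHom (d 0)) (ModuleCat.ofHom ε)
            (ModuleCat.hom_ext (LinearMap.ext fun x => hdε.apply_apply_eq_zero x))).Exact :=
          (ShortComplex.moduleCat_exact_iff _).2 fun x hx => (hdε x).1 hx
        refine (ShortComplex.exact_and_epi_g_iff_of_iso ?_).2
          ⟨hE, (ModuleCat.epi_iff_surjective _).2 hε⟩
        exact ShortComplex.isoMk (Iso.refl _) (Iso.refl _) (Iso.refl _)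
          (by simp; exact (freeComplex_d d hd 0).symm)
          ((Category.id_comp _).trans (Category.comp_id _).symm)
      all_goals rfl
    | succ n =>
      rw [quasiIsoAt_iff_exactAt' _ _ (ChainComplex.exactAt_succ_single_obj _ _),
        HomologicalComplex.exactAt_iff' _ (n + 1 + 1) (n + 1) n (by simp) (by simp),
        ShortComplex.moduleCat_exact_iff]
      intro x hx
      change ((freeComplex d hd).d (n + 1) n).hom x = 0 at hx
      rw [freeComplex_d] at hx
      obtain ⟨y, hy⟩ := (hd n x).1 hx
      refine ⟨y, ?_⟩
      change ((freeComplex d hd).d (n + 1 + 1) (n + 1)).hom y = x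
      rw [freeComplex_d]
      exact hy⟩

variable (dB : ∀ n, (I (n + 1) → B) →ₗ[k] (I n → B))
  (hdB : ∀ n (b : B) (r : I (n + 1) → R), dB n (fun i => op (r i) • b) = fun i => op (d n r i) • b)

/-- The identification of `B ⊗_R R^(I n)` with `B^(I n)`. -/
def freeComplexTensorEquiv (n : ℕ) :
    (tensorFunctor k R B).obj ((freeComplex d hd).X n) ≃ₗ[k] (I n → B) :=
  tensorFunctorFreeEquiv k R B (N := (freeComplex d hd).X n) (LinearEquiv.refl R (I n → R))

include hdB in
theorem freeComplex_tensor_d (n : ℕ)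
    (x : (tensorFunctor k R B).obj ((freeComplex d hd).X (n + 1))) :
    freeComplexTensorEquiv k B d hd n (((tensorFunctor k R B).map ((freeComplex d hd).d (n + 1) n)).hom x) =
      dB n (freeComplexTensorEquiv k B d hd (n + 1) x) := by
  refine tensorFunctorFreeEquiv_map k _ _ _ _ (fun b r => ?_) x
  rw [freeComplex_d]
  exact hdB n b r

include hd hε hdε hdB in
theorem rank_tor_succ (n : ℕ) (s : (I (n + 1) → B) →ₗ[k] (I (n + 2) → B))
    (t : (I n → B) →ₗ[k] (I (n + 1) → B)) (p : (I (n + 1) → B) →ₗ[k] (I (n + 1) → B))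
    (h : ∀ x, dB (n + 1) (s x) + t (dB n x) + p x = x) (hpp : ∀ x, p (p x) = p x)
    (hpd : ∀ x, p (dB (n + 1) x) = 0) (hdp : ∀ x, dB n (p x) = 0) :
    Module.rank k (tor k R B (n + 1) M) = Module.rank k (LinearMap.range p) := by
  let K := ((tensorFunctor k R B).mapHomologicalComplex _).obj (freeComplex d hd)
  rw [tor, ((freeResolution d hd M ε hε hdε).isoLeftDerivedObj (tensorFunctor k R B)
    (n + 1)).toLinearEquiv.rank_eq]
  change Module.rank k (K.homology (n + 1)) = _
  rw [(K.homologyIsoSc' (n + 2) (n + 1) n (by simp) (by simp)).toLinearEquiv.rank_eq]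
  refine rank_homology_eq_rank_range _ (freeComplexTensorEquiv k B d hd _)
    (freeComplexTensorEquiv k B d hd _) (freeComplexTensorEquiv k B d hd _)
    (dB (n + 1)) (dB n) (fun x => ?_) (fun x => ?_) s t p h hpp hpd hdp
  · exact freeComplex_tensor_d k B d hd dB hdB _ x
  · exact freeComplex_tensor_d k B d hd dB hdB _ x

include hd hε hdε hdB in
theorem rank_tor_zero (s : (I 0 → B) →ₗ[k] (I 1 → B)) (p : (I 0 → B) →ₗ[k] (I 0 → B))
    (h : ∀ x, dB 0 (s x) + p x = x) (hpp : ∀ x, p (p x) = p x) (hpd : ∀ x, p (dB 0 x) = 0) :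
    Module.rank k (tor k R B 0 M) = Module.rank k (LinearMap.range p) := by
  let K := ((tensorFunctor k R B).mapHomologicalComplex _).obj (freeComplex d hd)
  rw [tor, ((freeResolution d hd M ε hε hdε).isoLeftDerivedObj (tensorFunctor k R B)
    0).toLinearEquiv.rank_eq]
  change Module.rank k (K.homology 0) = _
  -- There is no degree below `0`: the short complex uses degree `0` twice, and its second map is
  -- the component from `0` to `0`, which vanishes. Hence `g = 0` below.
  rw [(K.homologyIsoSc' 1 0 0 (by simp) (by simp)).toLinearEquiv.rank_eq]
  refine rank_homology_eq_rank_range _ (freeComplexTensorEquiv k B d hd _)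
    (freeComplexTensorEquiv k B d hd _) (freeComplexTensorEquiv k B d hd _)
    (dB 0) 0 (fun x => ?_) (fun x => ?_) s 0 p (by simpa using h) hpp hpd (fun _ => rfl)
  · exact freeComplex_tensor_d k B d hd dB hdB _ x
  · have : (K.sc' 1 0 0).g = 0 := K.shape 0 0 (by simp)
    rw [show ((K.sc' 1 0 0).g).hom x = 0 by rw [this]; rfl]
    exact map_zero _

end FreeResolution

/-! ### The monomial basis of a quantum complete intersection -/

section Monomials

variable {k : Type u} [Field k] (q : k) (a b : ℕ)

/-- The generator `X`. -/
def genX : QuantumCI q a b := RingQuot.mkAlgHom k (QCIRel q a b) (FreeAlgebra.ι k 0)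

/-- The generator `Y`. -/
def genY : QuantumCI q a b := RingQuot.mkAlgHom k (QCIRel q a b) (FreeAlgebra.ι k 1)

theorem genX_pow : genX q a b ^ a = 0 := by
  rw [genX, ← map_pow, RingQuot.mkAlgHom_rel k QCIRel.x_pow, map_zero]

theorem genY_pow : genY q a b ^ b = 0 := by
  rw [genY, ← map_pow, RingQuot.mkAlgHom_rel k QCIRel.y_pow, map_zero]

theorem genX_mul_genY : genX q a b * genY q a b = q • (genY q a b * genX q a b) := by
  rw [genX, genY, ← map_mul, RingQuot.mkAlgHom_rel k QCIRel.comm, map_smul, map_mul]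

theorem genX_mul_genY_pow (n : ℕ) :
    genX q a b * genY q a b ^ n = q ^ n • (genY q a b ^ n * genX q a b) := by
  induction n with
  | zero => simp
  | succ n ih =>
    rw [pow_succ, ← mul_assoc, ih, smul_mul_assoc, mul_assoc, genX_mul_genY, mul_smul_comm,
      smul_smul, mul_assoc, pow_succ]

theorem genX_pow_mul_genY_pow (m n : ℕ) :
    genX q a b ^ m * genY q a b ^ n = q ^ (m * n) • (genY q a b ^ n * genX q a b ^ m) := by
  induction m with
  | zero => simp
  | succ m ih =>
    rw [pow_succ', mul_assoc, ih, mul_smul_comm, ← mul_assoc, genX_mul_genY_pow, smul_mul_assoc,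
      smul_smul, mul_assoc]
    congr 1
    ring

/-- The monomial `Y ^ v * X ^ u`. -/
def monomial (v u : ℕ) : QuantumCI q a b := genY q a b ^ v * genX q a b ^ u

variable {a b} in
theorem monomial_eq_zero {v u : ℕ} (h : b ≤ v ∨ a ≤ u) : monomial q a b v u = 0 := by
  rcases h with h | h
  · rw [monomial, pow_eq_zero_of_le h (genY_pow q a b), zero_mul]
  · rw [monomial, pow_eq_zero_of_le h (genX_pow q a b), mul_zero]

theorem monomial_zero_zero : monomial q a b 0 0 = 1 := by simp [monomial]

theorem monomial_mul_monomial (v u v' u' : ℕ) :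
    monomial q a b v u * monomial q a b v' u' =
      q ^ (u * v') • monomial q a b (v + v') (u + u') := by
  rw [monomial, monomial, monomial, mul_assoc, ← mul_assoc (_ ^ u), genX_pow_mul_genY_pow,
    smul_mul_assoc, mul_smul_comm, pow_add, pow_add]
  simp only [mul_assoc]

/-- The span contains `1`, `X`, `Y`, and the commutation rule makes it closed under products. -/
theorem span_monomial :
    Submodule.span k (Set.range fun p : ℕ × ℕ => monomial q a b p.1 p.2) = ⊤ := by
  set S := Submodule.span k (Set.range fun p : ℕ × ℕ => monomial q a b p.1 p.2) with hS
  have hmem (v u : ℕ) : monomial q a b v u ∈ S := Submodule.subset_span ⟨(v, u), rfl⟩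
  have hmul : S * S ≤ S := by
    rw [hS, Submodule.span_mul_span, Submodule.span_le]
    rintro _ ⟨_, ⟨p, rfl⟩, _, ⟨p', rfl⟩, rfl⟩
    simp only [SetLike.mem_coe]
    rw [monomial_mul_monomial]
    exact Submodule.smul_mem _ _ (hmem _ _)
  rw [eq_top_iff]
  rintro z -
  obtain ⟨w, rfl⟩ := RingQuot.mkAlgHom_surjective k (QCIRel q a b) z
  induction w using FreeAlgebra.induction with
  | grade0 r =>
    rw [AlgHom.commutes, Algebra.algebraMap_eq_smul_one, ← monomial_zero_zero]
    exact Submodule.smul_mem _ _ (hmem _ _)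
  | grade1 i =>
    fin_cases i
    · have := hmem 0 1
      rwa [monomial, pow_zero, pow_one, one_mul] at this
    · have := hmem 1 0
      rwa [monomial, pow_zero, pow_one, mul_one] at this
  | mul w w' h h' => rw [map_mul]; exact hmul (Submodule.mul_mem_mul h h')
  | add w w' h h' => rw [map_add]; exact Submodule.add_mem _ h h'

/-- The action of `X` on the functions of the exponents of the monomials. -/
def shiftX : Module.End k (ℕ × ℕ → k) where
  toFun f p := if 1 ≤ p.2 ∧ p.2 < a then q ^ p.1 * f (p.1, p.2 - 1) else 0
  map_add' f g := by ext p; simp only [Pi.add_apply]; split_ifs <;> ring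
  map_smul' c f := by ext p; simp only [Pi.smul_apply, smul_eq_mul, RingHom.id_apply]; split_ifs <;> ring

/-- The action of `Y` on the functions of the exponents of the monomials. -/
def shiftY : Module.End k (ℕ × ℕ → k) where
  toFun f p := if 1 ≤ p.1 ∧ p.1 < b then f (p.1 - 1, p.2) else 0
  map_add' f g := by ext p; simp only [Pi.add_apply]; split_ifs <;> ring
  map_smul' c f := by ext p; simp only [Pi.smul_apply, smul_eq_mul, RingHom.id_apply]; split_ifs <;> ring

theorem shiftX_apply (f : ℕ × ℕ → k) (v u : ℕ) :
    shiftX q a f (v, u) = if 1 ≤ u ∧ u < a then q ^ v * f (v, u - 1) else 0 := rfl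

theorem shiftY_apply (f : ℕ × ℕ → k) (v u : ℕ) :
    shiftY b f (v, u) = if 1 ≤ v ∧ v < b then f (v - 1, u) else 0 := rfl

/-- The exponent is `n + 1` because the power `0` is the identity, which does not truncate at `u <
a`. -/
theorem shiftX_pow_apply (n : ℕ) (f : ℕ × ℕ → k) (v u : ℕ) :
    (shiftX q a ^ (n + 1)) f (v, u) =
      if n + 1 ≤ u ∧ u < a then q ^ (v * (n + 1)) * f (v, u - (n + 1)) else 0 := by
  induction n generalizing u with
  | zero => simp [shiftX_apply]
  | succ n ih =>
    rw [pow_succ', Module.End.mul_apply, shiftX_apply]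
    by_cases h : n + 2 ≤ u ∧ u < a
    · rw [if_pos (by omega), ih, if_pos (by omega), if_pos (by omega), ← mul_assoc, ← pow_add]
      congr 2
      · ring
      · congr 1; omega
    · rw [if_neg (by omega : ¬(n + 1 + 1 ≤ u ∧ u < a))]
      split_ifs with h'
      · rw [ih, if_neg (by omega), mul_zero]
      · rfl

theorem shiftY_pow_apply (n : ℕ) (f : ℕ × ℕ → k) (v u : ℕ) :
    (shiftY b ^ (n + 1)) f (v, u) =
      if n + 1 ≤ v ∧ v < b then f (v - (n + 1), u) else 0 := by
  induction n generalizing v with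
  | zero => simp [shiftY_apply]
  | succ n ih =>
    rw [pow_succ', Module.End.mul_apply, shiftY_apply]
    by_cases h : n + 2 ≤ v ∧ v < b
    · rw [if_pos (by omega), ih, if_pos (by omega), if_pos (by omega)]
      congr 2; omega
    · rw [if_neg (by omega : ¬(n + 1 + 1 ≤ v ∧ v < b))]
      split_ifs with h'
      · rw [ih, if_neg (by omega)]
      · rfl

variable {a b} (ha : 0 < a) (hb : 0 < b)

/-- The regular representation in the coordinates of the monomials. -/
def shiftRep : QuantumCI q a b →ₐ[k] Module.End k (ℕ × ℕ → k) :=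
  RingQuot.liftAlgHom k ⟨FreeAlgebra.lift k ![shiftX q a, shiftY b], by
    intro w w' h
    cases h with
    | x_pow =>
      obtain ⟨m, rfl⟩ := Nat.exists_eq_add_of_le' ha
      ext f ⟨v, u⟩
      simp only [map_pow, FreeAlgebra.lift_ι_apply, Matrix.cons_val_zero, map_zero]
      rw [shiftX_pow_apply, if_neg (by omega)]
      rfl
    | comm =>
      ext f ⟨v, u⟩
      simp only [map_mul, map_smul, FreeAlgebra.lift_ι_apply, Matrix.cons_val_zero,
        Matrix.cons_val_one, LinearMap.smul_apply, Module.End.mul_apply, Pi.smul_apply,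
        smul_eq_mul, shiftX_apply, shiftY_apply]
      split_ifs with h₁ h₂ h₂
      · obtain ⟨m, rfl⟩ := Nat.exists_eq_add_of_le' h₂.1
        rw [Nat.add_sub_cancel]
        ring
      all_goals ring
    | y_pow =>
      obtain ⟨m, rfl⟩ : ∃ m, b = m + 1 := ⟨b - 1, by omega⟩
      ext f ⟨v, u⟩
      rw [map_pow, FreeAlgebra.lift_ι_apply, map_zero]
      change (shiftY (m + 1) ^ (m + 1)) f (v, u) = 0
      rw [shiftY_pow_apply, if_neg (by omega)]⟩

theorem shiftRep_genX : shiftRep q ha hb (genX q a b) = shiftX q a := by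
  simp [shiftRep, genX]

theorem shiftRep_genY : shiftRep q ha hb (genY q a b) = shiftY b := by
  simp [shiftRep, genY]

theorem shiftX_single (v u : ℕ) (h : u + 1 < a) :
    shiftX q a (Pi.single (v, u) 1) = q ^ v • Pi.single (v, u + 1) 1 := by
  ext ⟨v', u'⟩
  rw [shiftX_apply]
  simp only [Pi.smul_apply, Pi.single_apply, Prod.mk.injEq, smul_eq_mul]
  by_cases h' : v' = v ∧ u' = u + 1
  · rw [if_pos (by omega), if_pos (by omega), if_pos h', h'.1]
  · rw [if_neg h', mul_zero]
    split_ifs <;> first | rfl | omega | simp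

theorem shiftY_single (v u : ℕ) (h : v + 1 < b) :
    shiftY (k := k) b (Pi.single (v, u) 1) = Pi.single (v + 1, u) 1 := by
  ext ⟨v', u'⟩
  rw [shiftY_apply]
  simp only [Pi.single_apply, Prod.mk.injEq]
  split_ifs <;> first | rfl | omega

theorem shiftRep_monomial (v u : ℕ) (hv : v < b) (hu : u < a) :
    shiftRep q ha hb (monomial q a b v u) (Pi.single (0, 0) 1) = Pi.single (v, u) 1 := by
  rw [monomial, map_mul, map_pow, map_pow, shiftRep_genX, shiftRep_genY, Module.End.mul_apply]
  have hX : ∀ u < a, (shiftX q a ^ u) (Pi.single (0, 0) 1) = Pi.single (0, u) 1 := by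
    intro u hu
    induction u with
    | zero => rfl
    | succ u ih =>
      rw [pow_succ', Module.End.mul_apply, ih (by omega), shiftX_single q _ _ hu, pow_zero,
        one_smul]
  rw [hX u hu]
  induction v with
  | zero => rfl
  | succ v ih => rw [pow_succ', Module.End.mul_apply, ih (by omega), shiftY_single _ _ hv]

-- In the regular representation the monomial `Y ^ v * X ^ u` moves the delta function at `(0, 0)`
-- to the one at `(v, u)`, and delta functions at distinct points are independent.
include ha hb in
theorem linearIndependent_monomial :
    LinearIndependent k fun p : Fin b × Fin a => monomial q a b p.1 p.2 := by
  refine LinearIndependent.of_comp ((LinearMap.applyₗ (Pi.single (0, 0) 1)) ∘ₗ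
    (shiftRep q ha hb).toLinearMap) ?_
  have h := (Pi.linearIndependent_single_one (ℕ × ℕ) k).comp
    (fun p : Fin b × Fin a => ((p.1 : ℕ), (p.2 : ℕ))) (by
      rintro ⟨v, u⟩ ⟨v', u'⟩ h
      simpa [Fin.ext_iff] using h)
  convert h using 1
  funext p
  exact shiftRep_monomial q ha hb p.1 p.2 p.1.2 p.2.2

theorem span_monomial_fin :
    ⊤ ≤ Submodule.span k (Set.range fun p : Fin b × Fin a => monomial q a b p.1 p.2) := by
  rw [← span_monomial q a b, Submodule.span_le]
  rintro _ ⟨⟨v, u⟩, rfl⟩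
  by_cases h : b ≤ v ∨ a ≤ u
  · simp only [monomial_eq_zero q h]
    exact Submodule.zero_mem _
  · exact Submodule.subset_span ⟨(⟨v, by omega⟩, ⟨u, by omega⟩), rfl⟩

/-- The monomials `Y ^ v * X ^ u` with `v < b` and `u < a` form a basis. -/
def monomialBasis : Module.Basis (Fin b × Fin a) k (QuantumCI q a b) :=
  Module.Basis.mk (linearIndependent_monomial q ha hb) (span_monomial_fin q)

theorem monomialBasis_apply (p : Fin b × Fin a) :
    monomialBasis q ha hb p = monomial q a b p.1 p.2 := Module.Basis.mk_apply _ _ _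

end Monomials

/-! ### Total complexes of families indexed by `ℕ × ℕ` -/

section Total

/-- The index set of the degree `n` part of a total complex. -/
abbrev Idx (n : ℕ) : Type := {p : ℕ × ℕ // p ∈ Finset.HasAntidiagonal.antidiagonal n}

section Defs

variable {S M : Type*} [Ring S] [AddCommGroup M] [Module S M]

variable (S M) in
/-- Extension by zero of a family of degree `n`. -/
def extendIdx (n : ℕ) : (Idx n → M) →ₗ[S] (ℕ → ℕ → M) where
  toFun f i j := if h : (i, j) ∈ Finset.HasAntidiagonal.antidiagonal n then f ⟨(i, j), h⟩ else 0
  map_add' f g := by ext i j; simp only [Pi.add_apply]; split_ifs <;> simp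
  map_smul' c f := by ext i j; simp only [Pi.smul_apply, RingHom.id_apply]; split_ifs <;> simp

variable (S M) in
/-- The degree `n` part of a family. -/
def restrictIdx (n : ℕ) : (ℕ → ℕ → M) →ₗ[S] (Idx n → M) where
  toFun F p := F p.1.1 p.1.2
  map_add' _ _ := rfl
  map_smul' _ _ := rfl

theorem extendIdx_of_eq {n : ℕ} (f : Idx n → M) {i j : ℕ} (h : i + j = n) :
    extendIdx S M n f i j = f ⟨(i, j), Finset.HasAntidiagonal.mem_antidiagonal.2 h⟩ :=
  dif_pos (Finset.HasAntidiagonal.mem_antidiagonal.2 h)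

theorem extendIdx_of_ne {n : ℕ} (f : Idx n → M) {i j : ℕ} (h : i + j ≠ n) :
    extendIdx S M n f i j = 0 :=
  dif_neg (fun h' => h (Finset.HasAntidiagonal.mem_antidiagonal.1 h'))

theorem restrictIdx_extendIdx {n : ℕ} (f : Idx n → M) :
    restrictIdx S M n (extendIdx S M n f) = f := by
  ext ⟨⟨i, j⟩, h⟩
  exact dif_pos h

theorem extendIdx_restrictIdx {n : ℕ} (F : ℕ → ℕ → M) (hF : ∀ i j, i + j ≠ n → F i j = 0) :
    extendIdx S M n (restrictIdx S M n F) = F := by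
  ext i j
  by_cases h : i + j = n
  · rw [extendIdx_of_eq _ h]; rfl
  · rw [extendIdx_of_ne _ h, hF i j h]

/-- The total differential of the families of maps `X i j` from position `(i + 1, j)` to `(i, j)`
and `Y i j` from position `(i, j + 1)` to `(i, j)`. -/
def totalD (X Y : ℕ → ℕ → M →ₗ[S] M) : (ℕ → ℕ → M) →ₗ[S] (ℕ → ℕ → M) where
  toFun F i j := X i j (F (i + 1) j) + (-1 : ℤ) ^ i • Y i j (F i (j + 1))
  map_add' F G := by
    ext i j
    simp only [Pi.add_apply, map_add, smul_add]
    abel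
  map_smul' c F := by
    ext i j
    simp only [Pi.smul_apply, map_smul, smul_add, RingHom.id_apply]
    rw [smul_comm]

theorem totalD_apply (X Y : ℕ → ℕ → M →ₗ[S] M) (F : ℕ → ℕ → M) (i j : ℕ) :
    totalD X Y F i j = X i j (F (i + 1) j) + (-1 : ℤ) ^ i • Y i j (F i (j + 1)) := rfl

/-- The total operator of the families of maps `s i j` from position `(i, j)` to `(i + 1, j)`
and `t j` from position `(0, j)` to `(0, j + 1)`. -/
def totalH (s : ℕ → ℕ → M →ₗ[S] M) (t : ℕ → M →ₗ[S] M) : (ℕ → ℕ → M) →ₗ[S] (ℕ → ℕ → M) where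
  toFun F
    | 0, 0 => 0
    | 0, j + 1 => t j (F 0 j)
    | i + 1, j => s i j (F i j)
  map_add' F G := by
    ext i j
    rcases i with _ | i <;> rcases j with _ | j <;> simp
  map_smul' c F := by
    ext i j
    rcases i with _ | i <;> rcases j with _ | j <;> simp

/-- The diagonal operator of a family of maps. -/
def diagP (P : ℕ → ℕ → M →ₗ[S] M) : (ℕ → ℕ → M) →ₗ[S] (ℕ → ℕ → M) where
  toFun F i j := P i j (F i j)
  map_add' F G := by ext; simp
  map_smul' c F := by ext; simp

/-- The degree `n` part of the total differential. -/
def totalDiff (X Y : ℕ → ℕ → M →ₗ[S] M) (n : ℕ) : (Idx (n + 1) → M) →ₗ[S] (Idx n → M) :=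
  restrictIdx S M n ∘ₗ totalD X Y ∘ₗ extendIdx S M (n + 1)

/-- The degree `n` part of the total operator of `s` and `t`. -/
def totalHtpy (s : ℕ → ℕ → M →ₗ[S] M) (t : ℕ → M →ₗ[S] M) (n : ℕ) :
    (Idx n → M) →ₗ[S] (Idx (n + 1) → M) :=
  restrictIdx S M (n + 1) ∘ₗ totalH s t ∘ₗ extendIdx S M n

/-- The degree `n` part of a diagonal operator. -/
def diagIdx (P : ℕ → ℕ → M →ₗ[S] M) (n : ℕ) : (Idx n → M) →ₗ[S] (Idx n → M) :=
  restrictIdx S M n ∘ₗ diagP P ∘ₗ extendIdx S M n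

theorem diagIdx_apply (P : ℕ → ℕ → M →ₗ[S] M) (n : ℕ) (f : Idx n → M) (p : Idx n) :
    diagIdx P n f p = P p.1.1 p.1.2 (f p) := by
  obtain ⟨⟨i, j⟩, h⟩ := p
  exact congrArg (P i j) (dif_pos h)

/-- Identities can thus be checked on families over all of `ℕ × ℕ`, without transport between
antidiagonals, and then restricted to one degree. -/
theorem extendIdx_totalDiff (X Y : ℕ → ℕ → M →ₗ[S] M) (n : ℕ) (f : Idx (n + 1) → M) :
    extendIdx S M n (totalDiff X Y n f) = totalD X Y (extendIdx S M (n + 1) f) := by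
  refine extendIdx_restrictIdx (totalD X Y (extendIdx S M (n + 1) f)) fun i j h => ?_
  rw [totalD_apply, extendIdx_of_ne _ (by omega), extendIdx_of_ne _ (by omega)]
  simp

theorem extendIdx_totalHtpy (s : ℕ → ℕ → M →ₗ[S] M) (t : ℕ → M →ₗ[S] M) (n : ℕ)
    (f : Idx n → M) :
    extendIdx S M (n + 1) (totalHtpy s t n f) = totalH s t (extendIdx S M n f) := by
  refine extendIdx_restrictIdx (totalH s t (extendIdx S M n f)) fun i j h => ?_
  rcases i with _ | i
  · rcases j with _ | j
    · rfl
    · change t j (extendIdx S M n f 0 j) = 0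
      rw [extendIdx_of_ne _ (by omega), map_zero]
  · change s i j (extendIdx S M n f i j) = 0
    rw [extendIdx_of_ne _ (by omega), map_zero]

theorem extendIdx_injective (n : ℕ) : Function.Injective (extendIdx S M n) :=
  Function.LeftInverse.injective (g := restrictIdx S M n) restrictIdx_extendIdx

end Defs

variable {S S' M : Type*} [Ring S] [Ring S'] [AddCommGroup M] [Module S M] [Module S' M]
  (X Y : ℕ → ℕ → M →ₗ[S] M) (s : ℕ → ℕ → M →ₗ[S'] M) (t : ℕ → M →ₗ[S'] M)
  (P : ℕ → ℕ → M →ₗ[S'] M)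

theorem totalD_totalD (hXX : ∀ i j z, X i j (X (i + 1) j z) = 0)
    (hYY : ∀ i j z, Y i j (Y i (j + 1) z) = 0)
    (hXY : ∀ i j z, X i j (Y (i + 1) j z) = Y i j (X i (j + 1) z)) (F : ℕ → ℕ → M) :
    totalD X Y (totalD X Y F) = 0 := by
  ext i j
  simp only [totalD_apply, map_add, map_zsmul, hXX, hYY, hXY, pow_succ, Pi.zero_apply]
  simp

variable (hX : ∀ i j z, X (i + 1) j (s (i + 1) j z) + s i j (X i j z) + P (i + 1) j z = z)
  (hY : ∀ i j z, Y (i + 1) j (s i (j + 1) z) = s i j (Y i j z))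
  (h₁ : ∀ j z, X 0 (j + 1) (s 0 (j + 1) z) + Y 0 (j + 1) (t (j + 1) z) + t j (Y 0 j z) +
    P 0 (j + 1) z = z)
  (htX : ∀ j z, t j (X 0 j z) = 0)
  (h₀ : ∀ z, X 0 0 (s 0 0 z) + Y 0 0 (t 0 z) + P 0 0 z = z)

-- The homotopy `s` contracts the `X`-direction up to `P` for `i ≥ 1`. It commutes with `Y`, so the
-- mixed terms cancel by the sign `(-1) ^ i`. Its defect at `i = 0` is repaired by `t`, which runs
-- along the column `i = 0` and kills the image of `X`.
include hX hY h₁ htX h₀ in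
theorem totalD_totalH (F : ℕ → ℕ → M) :
    totalD X Y (totalH s t F) + totalH s t (totalD X Y F) + diagP P F = F := by
  ext i j
  rcases i with _ | i
  · rcases j with _ | j
    · change X 0 0 (s 0 0 (F 0 0)) + (-1 : ℤ) ^ 0 • Y 0 0 (t 0 (F 0 0)) + 0 + P 0 0 (F 0 0) = _
      rw [pow_zero, one_smul, add_zero, h₀]
    · change X 0 (j + 1) (s 0 (j + 1) (F 0 (j + 1))) +
        (-1 : ℤ) ^ 0 • Y 0 (j + 1) (t (j + 1) (F 0 (j + 1))) +
        t j (X 0 j (F 1 j) + (-1 : ℤ) ^ 0 • Y 0 j (F 0 (j + 1))) + P 0 (j + 1) (F 0 (j + 1)) = _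
      rw [pow_zero, one_smul, one_smul, map_add, htX, zero_add, h₁]
  · change X (i + 1) j (s (i + 1) j (F (i + 1) j)) +
        (-1 : ℤ) ^ (i + 1) • Y (i + 1) j (s i (j + 1) (F i (j + 1))) +
        s i j (X i j (F (i + 1) j) + (-1 : ℤ) ^ i • Y i j (F i (j + 1))) +
        P (i + 1) j (F (i + 1) j) = _
    rw [map_add, map_zsmul, hY]
    rw [pow_succ, mul_neg_one, neg_smul]
    conv_rhs => rw [← hX i j (F (i + 1) j)]
    abel

include hX hY h₁ htX h₀ in
theorem totalDiff_totalHtpy (n : ℕ) (f : Idx (n + 1) → M) :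
    totalDiff X Y (n + 1) (totalHtpy s t (n + 1) f) + totalHtpy s t n (totalDiff X Y n f) +
      diagIdx P (n + 1) f = f := by
  -- The differential is `S`-linear and the homotopy only `S'`-linear; extension by zero does not
  -- depend on the scalars, so `ℤ` serves for both.
  have h := totalD_totalH X Y s t P hX hY h₁ htX h₀ (extendIdx ℤ M (n + 1) f)
  have e₁ : totalDiff X Y (n + 1) (totalHtpy s t (n + 1) f) =
      restrictIdx ℤ M (n + 1) (totalD X Y (totalH s t (extendIdx ℤ M (n + 1) f))) :=
    congrArg (fun F => restrictIdx ℤ M (n + 1) (totalD X Y F)) (extendIdx_totalHtpy s t (n + 1) f)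
  have e₂ : totalHtpy s t n (totalDiff X Y n f) =
      restrictIdx ℤ M (n + 1) (totalH s t (totalD X Y (extendIdx ℤ M (n + 1) f))) :=
    congrArg (fun F => restrictIdx ℤ M (n + 1) (totalH s t F)) (extendIdx_totalDiff X Y n f)
  have e₃ : diagIdx P (n + 1) f =
      restrictIdx ℤ M (n + 1) (diagP P (extendIdx ℤ M (n + 1) f)) := rfl
  rw [e₁, e₂, e₃, ← map_add, ← map_add, h, restrictIdx_extendIdx]

include hX hY h₁ htX h₀ in
theorem totalDiff_totalHtpy_zero (f : Idx 0 → M) :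
    totalDiff X Y 0 (totalHtpy s t 0 f) + diagIdx P 0 f = f := by
  have h := totalD_totalH X Y s t P hX hY h₁ htX h₀ (extendIdx ℤ M 0 f)
  have e₁ : totalDiff X Y 0 (totalHtpy s t 0 f) =
      restrictIdx ℤ M 0 (totalD X Y (totalH s t (extendIdx ℤ M 0 f))) :=
    congrArg (fun F => restrictIdx ℤ M 0 (totalD X Y F)) (extendIdx_totalHtpy s t 0 f)
  -- The homotopy has no component ending at `(0, 0)`, so the second term is absent in degree `0`.
  have e₂ : restrictIdx ℤ M 0 (totalH s t (totalD X Y (extendIdx ℤ M 0 f))) = 0 := by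
    ext ⟨⟨i, j⟩, hij⟩
    obtain ⟨rfl, rfl⟩ : i = 0 ∧ j = 0 := by simpa using hij
    rfl
  have e₃ : diagIdx P 0 f = restrictIdx ℤ M 0 (diagP P (extendIdx ℤ M 0 f)) := rfl
  rw [e₁, ← add_zero (restrictIdx ℤ M 0 _), ← e₂, e₃, ← map_add, ← map_add, h,
    restrictIdx_extendIdx]

theorem totalDiff_totalDiff (hXX : ∀ i j z, X i j (X (i + 1) j z) = 0)
    (hYY : ∀ i j z, Y i j (Y i (j + 1) z) = 0)
    (hXY : ∀ i j z, X i j (Y (i + 1) j z) = Y i j (X i (j + 1) z)) (n : ℕ)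
    (f : Idx (n + 2) → M) : totalDiff X Y n (totalDiff X Y (n + 1) f) = 0 := by
  apply extendIdx_injective (S := S)
  rw [extendIdx_totalDiff, extendIdx_totalDiff, totalD_totalD X Y hXX hYY hXY, map_zero]

end Total

/-! ### The bimodule resolution of a truncated polynomial algebra -/

section Truncated

variable (k : Type u) [Field k]

/-- The space underlying `k[x] / (x ^ a) ⊗ k[x] / (x ^ a)`. -/
abbrev BiTrunc (a : ℕ) : Type u := Fin a × Fin a → k

/-- The element `x ^ u ⊗ x ^ u'`. -/
def biPow (a u u' : ℕ) : BiTrunc k a :=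
  if h : u < a ∧ u' < a then Pi.single (⟨u, h.1⟩, ⟨u', h.2⟩) 1 else 0

theorem biPow_of_le {a u u' : ℕ} (h : a ≤ u ∨ a ≤ u') : biPow k a u u' = 0 :=
  dif_neg (by omega)

variable {k}
variable {M : Type*} [AddCommGroup M] [Module k M]

/-- The linear map with given values at the elements `x ^ u ⊗ x ^ u'`. -/
def biLift (a : ℕ) (f : ℕ → ℕ → M) : BiTrunc k a →ₗ[k] M :=
  (Pi.basisFun k (Fin a × Fin a)).constr k fun p => f p.1 p.2

theorem biLift_biPow {a : ℕ} (f : ℕ → ℕ → M) {u u' : ℕ} (h : u < a) (h' : u' < a) :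
    biLift a f (biPow k a u u') = f u u' := by
  rw [biPow, dif_pos ⟨h, h'⟩, ← Pi.basisFun_apply, biLift, Module.Basis.constr_basis]

/-- If the prescribed values vanish out of range, the formula holds for all exponents, which frees
later computations from bounds. -/
theorem biLift_biPow' {a : ℕ} {f : ℕ → ℕ → M} (hf : ∀ u u', a ≤ u ∨ a ≤ u' → f u u' = 0)
    (u u' : ℕ) : biLift a f (biPow k a u u') = f u u' := by
  by_cases h : a ≤ u ∨ a ≤ u'
  · rw [biPow_of_le k h, map_zero, hf _ _ h]
  · exact biLift_biPow f (by omega) (by omega)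

theorem biTrunc_ext {a : ℕ} {φ ψ : BiTrunc k a →ₗ[k] M}
    (h : ∀ u u', u < a → u' < a → φ (biPow k a u u') = ψ (biPow k a u u')) : φ = ψ := by
  refine (Pi.basisFun k (Fin a × Fin a)).ext fun p => ?_
  have := h p.1 p.2 p.1.2 p.2.2
  rwa [biPow, dif_pos ⟨p.1.2, p.2.2⟩, ← Pi.basisFun_apply] at this

/-- The degree of the generator of the `i`-th term of the resolution. -/
def genDeg (a i : ℕ) : ℕ := i / 2 * a + i % 2

/-- The degree of the differential from the term `i + 1` to the term `i`. -/
def gap (a i : ℕ) : ℕ := if Even i then 1 else a - 1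

theorem gap_of_even {a i : ℕ} (h : Even i) : gap a i = 1 := if_pos h

theorem gap_of_not_even {a i : ℕ} (h : ¬ Even i) : gap a i = a - 1 := if_neg h

theorem genDeg_succ {a : ℕ} (ha : 0 < a) (i : ℕ) : genDeg a (i + 1) = genDeg a i + gap a i := by
  rcases Nat.even_or_odd' i with ⟨m, rfl | rfl⟩
  · rw [gap_of_even (even_two_mul m), genDeg, genDeg, show (2 * m + 1) / 2 = m by omega,
      show 2 * m / 2 = m by omega]
    omega
  · rw [gap_of_not_even (by simp), genDeg, genDeg, show (2 * m + 1 + 1) / 2 = m + 1 by omega,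
      show (2 * m + 1) / 2 = m by omega, add_mul]
    omega

variable (k) in
/-- The coefficients of the differential from the term `i + 1` to the term `i`. -/
def diffCoeff (i s : ℕ) : k := if Even i then (-1) ^ s else 1

/-- A sum over the terms of the differential from the term `i + 1` to the term `i`. -/
def diffSum (k : Type*) [Field k] {M : Type*} [AddCommGroup M] [Module k M] (a i : ℕ)
    (f : ℕ → ℕ → M) : M :=
  ∑ p ∈ Finset.HasAntidiagonal.antidiagonal (gap a i), diffCoeff k i p.2 • f p.1 p.2

theorem diffSum_of_even {a i : ℕ} (hi : Even i) (f : ℕ → ℕ → M) :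
    diffSum k a i f = f 1 0 - f 0 1 := by
  rw [diffSum, gap_of_even hi, Finset.Nat.sum_antidiagonal_eq_sum_range_succ
    (fun t s => diffCoeff k i s • f t s), Finset.sum_range_succ, Finset.sum_range_one]
  simp only [diffCoeff, if_pos hi]
  simp [sub_eq_add_neg, add_comm]

theorem diffSum_of_not_even {a i : ℕ} (ha : 0 < a) (hi : ¬ Even i) (f : ℕ → ℕ → M) :
    diffSum k a i f = ∑ t ∈ Finset.range a, f t (a - 1 - t) := by
  rw [diffSum, gap_of_not_even hi, Finset.Nat.sum_antidiagonal_eq_sum_range_succ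
    (fun t s => diffCoeff k i s • f t s), Nat.succ_eq_add_one, Nat.sub_add_cancel ha]
  simp only [diffCoeff, if_neg hi, one_smul]

theorem map_diffSum {N : Type*} [AddCommGroup N] [Module k N] (φ : M →ₗ[k] N) (a i : ℕ)
    (f : ℕ → ℕ → M) : φ (diffSum k a i f) = diffSum k a i fun t s => φ (f t s) := by
  simp [diffSum, map_sum]

theorem diffSum_congr {a i : ℕ} {f g : ℕ → ℕ → M} (h : ∀ t s, t + s = gap a i → f t s = g t s) :
    diffSum k a i f = diffSum k a i g :=
  Finset.sum_congr rfl fun p hp => by rw [h _ _ (Finset.HasAntidiagonal.mem_antidiagonal.1 hp)]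

theorem diffSum_eq_zero {a i : ℕ} {f : ℕ → ℕ → M} (h : ∀ t s, t + s = gap a i → f t s = 0) :
    diffSum k a i f = 0 :=
  Finset.sum_eq_zero fun p hp => by
    rw [h _ _ (Finset.HasAntidiagonal.mem_antidiagonal.1 hp), smul_zero]

variable (k)

/-- The differential from the term `i + 1` to the term `i`. -/
def biDiff (a i : ℕ) : BiTrunc k a →ₗ[k] BiTrunc k a :=
  biLift a fun u u' => diffSum k a i fun t s => biPow k a (u + t) (u' + s)

theorem biDiff_biPow (a i u u' : ℕ) : biDiff k a i (biPow k a u u') =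
    diffSum k a i fun t s => biPow k a (u + t) (u' + s) :=
  biLift_biPow' (fun u u' h => diffSum_eq_zero fun t s _ => biPow_of_le k (by omega)) u u'

/-- The contracting homotopy from the term `i` to the term `i + 1`. -/
def biHtpy (a i : ℕ) : BiTrunc k a →ₗ[k] BiTrunc k a :=
  biLift a fun u u' =>
    if Even i then ∑ t ∈ Finset.range u, biPow k a t (u' + (u - 1 - t))
    else if u + 1 = a then biPow k a 0 u' else 0

theorem biHtpy_biPow_of_even {a i u u' : ℕ} (hi : Even i) (hu : u < a) :
    biHtpy k a i (biPow k a u u') = ∑ t ∈ Finset.range u, biPow k a t (u' + (u - 1 - t)) := by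
  by_cases hu' : u' < a
  · rw [biHtpy, biLift_biPow _ hu hu', if_pos hi]
  · rw [biPow_of_le k (Or.inr (by omega)), map_zero, Finset.sum_eq_zero]
    exact fun t _ => biPow_of_le k (Or.inr (by omega))

theorem biHtpy_biPow_of_not_even {a i u u' : ℕ} (hi : ¬ Even i) :
    biHtpy k a i (biPow k a u u') = if u + 1 = a then biPow k a 0 u' else 0 := by
  by_cases h : u < a ∧ u' < a
  · rw [biHtpy, biLift_biPow _ h.1 h.2, if_neg hi]
  · rw [biPow_of_le k (by omega), map_zero]
    split_ifs with hu
    · rw [biPow_of_le k (by omega)]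
    · rfl

/-- The projection to `1 ⊗ k[x] / (x ^ a)` given by the multiplication. -/
def biProj (a : ℕ) : BiTrunc k a →ₗ[k] BiTrunc k a :=
  biLift a fun u u' => biPow k a 0 (u + u')

theorem biProj_biPow (a u u' : ℕ) :
    biProj k a (biPow k a u u') = biPow k a 0 (u + u') :=
  biLift_biPow' (fun u u' _ => biPow_of_le k (by omega)) u u'

theorem biProj_biDiff (a : ℕ) (z : BiTrunc k a) : biProj k a (biDiff k a 0 z) = 0 := by
  have : biProj k a ∘ₗ biDiff k a 0 = 0 := biTrunc_ext fun u u' _ _ => by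
    rw [LinearMap.comp_apply, biDiff_biPow, diffSum_of_even Even.zero, map_sub, biProj_biPow,
      biProj_biPow, LinearMap.zero_apply, sub_eq_zero]
    congr 1; omega
  exact LinearMap.congr_fun this z

/-- The sum telescopes: `x ⊗ 1 - 1 ⊗ x` divides `x ^ u ⊗ 1 - 1 ⊗ x ^ u` with the homotopy as
quotient. -/
theorem biDiff_biHtpy_of_even {a i u u' : ℕ} (hi : Even i) (hu : u < a) :
    biDiff k a i (biHtpy k a i (biPow k a u u')) = biPow k a u u' - biPow k a 0 (u + u') := by
  rw [biHtpy_biPow_of_even k hi hu, map_sum]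
  have (t) (ht : t ∈ Finset.range u) : biDiff k a i (biPow k a t (u' + (u - 1 - t))) =
      biPow k a (t + 1) (u' + (u - (t + 1))) - biPow k a t (u' + (u - t)) := by
    have := Finset.mem_range.1 ht
    rw [biDiff_biPow, diffSum_of_even hi]
    congr 2 <;> omega
  rw [Finset.sum_congr rfl this, Finset.sum_range_sub (fun t => biPow k a t (u' + (u - t)))]
  congr 2 <;> omega

theorem biDiff_biHtpy_zero (a : ℕ) (z : BiTrunc k a) :
    biDiff k a 0 (biHtpy k a 0 z) + biProj k a z = z := by
  have : biDiff k a 0 ∘ₗ biHtpy k a 0 + biProj k a = LinearMap.id :=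
    biTrunc_ext fun u u' hu _ => by
      rw [LinearMap.add_apply, LinearMap.comp_apply, biDiff_biHtpy_of_even k Even.zero hu,
        biProj_biPow, sub_add_cancel, LinearMap.id_apply]
  exact LinearMap.congr_fun this z

theorem biHtpy_biDiff_add (a i : ℕ) (z : BiTrunc k a) :
    biHtpy k a i (biDiff k a i z) + biDiff k a (i + 1) (biHtpy k a (i + 1) z) = z := by
  suffices h : biHtpy k a i ∘ₗ biDiff k a i + biDiff k a (i + 1) ∘ₗ biHtpy k a (i + 1) =
      LinearMap.id from LinearMap.congr_fun h z
  refine biTrunc_ext fun u u' hu hu' => ?_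
  rw [LinearMap.add_apply, LinearMap.comp_apply, LinearMap.comp_apply, LinearMap.id_apply]
  have ha : 0 < a := by omega
  by_cases hi : Even i
  · have hi' : ¬ Even (i + 1) := by rwa [Nat.even_add_one, not_not]
    rw [biDiff_biPow, diffSum_of_even hi, map_sub, biHtpy_biPow_of_not_even k hi',
      biHtpy_biPow_of_even k hi (by omega : u + 0 < a)]
    rcases Nat.lt_or_ge (u + 1) a with h | h
    · rw [if_neg h.ne, map_zero, add_zero, biHtpy_biPow_of_even k hi h, Finset.sum_range_succ,
        add_sub_right_comm, sub_eq_zero.2, zero_add]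
      · congr 1; omega
      · refine Finset.sum_congr rfl fun t ht => ?_
        have := Finset.mem_range.1 ht
        congr 1; omega
    -- Here `x ^ (u + 1) = 0`, so one homotopy term disappears. The sum left over is cancelled by
    -- the next differential, whose top term is the original element.
    · obtain rfl : a = u + 1 := by omega
      rw [if_pos rfl, biDiff_biPow, diffSum_of_not_even ha hi', Finset.sum_range_succ,
        biPow_of_le k (by omega : u + 1 ≤ u + 1 ∨ _), map_zero, zero_sub]
      have : ∑ t ∈ Finset.range u, biPow k (u + 1) (0 + t) (u' + (u + 1 - 1 - t)) =
          ∑ t ∈ Finset.range (u + 0), biPow k (u + 1) t (u' + 1 + (u + 0 - 1 - t)) := by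
        refine Finset.sum_congr rfl fun t ht => ?_
        have := Finset.mem_range.1 ht
        congr 1 <;> omega
      rw [this, neg_add_cancel_left]
      congr 1 <;> omega
  · have hi' : Even (i + 1) := by rwa [Nat.even_add_one]
    rw [biDiff_biHtpy_of_even k hi' hu, biDiff_biPow, diffSum_of_not_even ha hi, map_sum]
    -- The odd homotopy sees only the left exponent `a - 1`, so only the summand with `u + t = a -
    -- 1` contributes.
    rw [Finset.sum_eq_single (a - 1 - u)]
    · rw [biHtpy_biPow_of_not_even k hi, if_pos (by omega),
        show u' + (a - 1 - (a - 1 - u)) = u + u' by omega, add_sub_cancel]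
    · intro t _ ht
      rw [biHtpy_biPow_of_not_even k hi, if_neg (by omega)]
    · intro h
      exact absurd (Finset.mem_range.2 (by omega)) h

theorem biDiff_biDiff (a i : ℕ) (z : BiTrunc k a) : biDiff k a i (biDiff k a (i + 1) z) = 0 := by
  suffices h : biDiff k a i ∘ₗ biDiff k a (i + 1) = 0 from LinearMap.congr_fun h z
  refine biTrunc_ext fun u u' hu hu' => ?_
  rw [LinearMap.comp_apply, LinearMap.zero_apply]
  have ha : 0 < a := by omega
  -- The product of the two differentials telescopes to `x ^ a ⊗ 1 - 1 ⊗ x ^ a = 0`; the two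
  -- parities differ only in the order of the factors.
  have key : ∑ t ∈ Finset.range a, (biPow k a (u + t + 1) (u' + (a - 1 - t)) -
      biPow k a (u + t) (u' + (a - 1 - t) + 1)) = 0 := by
    have (t) (ht : t ∈ Finset.range a) : biPow k a (u + t + 1) (u' + (a - 1 - t)) -
        biPow k a (u + t) (u' + (a - 1 - t) + 1) =
        biPow k a (u + (t + 1)) (u' + (a - (t + 1))) - biPow k a (u + t) (u' + (a - t)) := by
      have := Finset.mem_range.1 ht
      congr 2 <;> omega
    rw [Finset.sum_congr rfl this, Finset.sum_range_sub (fun t => biPow k a (u + t) (u' + (a - t))),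
      biPow_of_le k (by omega), biPow_of_le k (by omega), sub_zero]
  by_cases hi : Even i
  · have hi' : ¬ Even (i + 1) := by rwa [Nat.even_add_one, not_not]
    rw [biDiff_biPow, diffSum_of_not_even ha hi', map_sum, ← key]
    refine Finset.sum_congr rfl fun t _ => ?_
    rw [biDiff_biPow, diffSum_of_even hi]
    rfl
  · have hi' : Even (i + 1) := by rwa [Nat.even_add_one]
    rw [biDiff_biPow, diffSum_of_even hi', map_sub, biDiff_biPow, biDiff_biPow,
      diffSum_of_not_even ha hi, diffSum_of_not_even ha hi, ← Finset.sum_sub_distrib, ← key]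
    refine Finset.sum_congr rfl fun t _ => ?_
    congr 2 <;> omega

end Truncated

/-! ### The bimodule resolution of a quantum complete intersection -/

section Resolution

variable {k : Type u} [Field k] (q : k) (a b : ℕ)

/-- The element `Y ^ v * X ^ u ⊗ Y ^ v' * X ^ u'` of the enveloping algebra. -/
def biMonomial (u u' v v' : ℕ) : Enveloping k (QuantumCI q a b) :=
  monomial q a b v u ⊗ₜ op (monomial q a b v' u')

variable {a b} in
theorem biMonomial_eq_zero {u u' v v' : ℕ} (h : (a ≤ u ∨ a ≤ u') ∨ b ≤ v ∨ b ≤ v') :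
    biMonomial q a b u u' v v' = 0 := by
  rw [biMonomial]
  by_cases h₁ : b ≤ v ∨ a ≤ u
  · rw [monomial_eq_zero q h₁, zero_tmul]
  · rw [monomial_eq_zero q (show b ≤ v' ∨ a ≤ u' by omega), op_zero, tmul_zero]

theorem biMonomial_mul_X (u u' v v' t s : ℕ) :
    biMonomial q a b u u' v v' * (monomial q a b 0 t ⊗ₜ op (monomial q a b 0 s)) =
      q ^ (s * v') • biMonomial q a b (u + t) (u' + s) v v' := by
  rw [biMonomial, biMonomial, Algebra.TensorProduct.tmul_mul_tmul, ← op_mul, monomial_mul_monomial,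
    monomial_mul_monomial, mul_zero, pow_zero, one_smul, op_smul, tmul_smul, zero_add, add_zero,
    add_comm s]

theorem biMonomial_mul_Y (u u' v v' t s : ℕ) :
    biMonomial q a b u u' v v' * (monomial q a b t 0 ⊗ₜ op (monomial q a b s 0)) =
      q ^ (u * t) • biMonomial q a b u u' (v + t) (v' + s) := by
  rw [biMonomial, biMonomial, Algebra.TensorProduct.tmul_mul_tmul, ← op_mul, monomial_mul_monomial,
    monomial_mul_monomial, zero_mul, pow_zero, one_smul, smul_tmul', zero_add, add_zero,
    add_comm s]

/-- The exponent of `q` that arises when the `X`-factors are moved to the left of the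
`Y`-factors. -/
def twistExp (i j u u' v v' : ℕ) : ℕ := (u + u' + genDeg a i) * v + u' * (genDeg b j + v')

/-- The identification of the tensor product of the terms of the resolutions of `k[x] / (x ^ a)`
and `k[y] / (y ^ b)` with the enveloping algebra, as a linear map. -/
def twistMap (i j : ℕ) : BiTrunc k a ⊗[k] BiTrunc k b →ₗ[k] Enveloping k (QuantumCI q a b) :=
  TensorProduct.lift <| biLift a fun u u' => biLift b fun v v' =>
    q ^ twistExp a b i j u u' v v' • biMonomial q a b u u' v v'

theorem twistMap_tmul (i j u u' v v' : ℕ) :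
    twistMap q a b i j (biPow k a u u' ⊗ₜ biPow k b v v') =
      q ^ twistExp a b i j u u' v v' • biMonomial q a b u u' v v' := by
  rw [twistMap, TensorProduct.lift.tmul, biLift_biPow', biLift_biPow']
  · intro v v' h
    rw [biMonomial_eq_zero q (Or.inr h), smul_zero]
  · intro u u' h
    refine biTrunc_ext fun v v' hv hv' => ?_
    rw [biLift_biPow _ hv hv', biMonomial_eq_zero q (Or.inl h), smul_zero, LinearMap.zero_apply]

theorem biTrunc_tensor_ext {k : Type u} [Field k] {a b : ℕ} {M : Type*} [AddCommGroup M]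
    [Module k M] {φ ψ : BiTrunc k a ⊗[k] BiTrunc k b →ₗ[k] M}
    (h : ∀ u u' v v', u < a → u' < a → v < b → v' < b →
      φ (biPow k a u u' ⊗ₜ biPow k b v v') = ψ (biPow k a u u' ⊗ₜ biPow k b v v')) : φ = ψ :=
  TensorProduct.ext <| biTrunc_ext fun u u' hu hu' => biTrunc_ext fun v v' hv hv' =>
    h u u' v v' hu hu' hv hv'

/-- The coefficient of the differential from the term `(i + 1, j)` to the term `(i, j)`. -/
def coeffX (i j : ℕ) : Enveloping k (QuantumCI q a b) :=
  diffSum k a i fun t s =>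
    q ^ (genDeg b j * s) • (monomial q a b 0 t ⊗ₜ[k] op (monomial q a b 0 s))

/-- The coefficient of the differential from the term `(i, j + 1)` to the term `(i, j)`. -/
def coeffY (i j : ℕ) : Enveloping k (QuantumCI q a b) :=
  diffSum k b j fun t s =>
    q ^ (genDeg a i * t) • (monomial q a b t 0 ⊗ₜ[k] op (monomial q a b s 0))

variable {a b}

/-- The factor `q ^ (genDeg b j * s)` in `coeffX` is what `X ^ s` acquires in passing a generator of
`Y`-degree `genDeg b j`. The exponents match because the `X`-degree of the generator drops by `t +
s`. -/
theorem twistMap_rTensor_biDiff (ha : 0 < a) (i j : ℕ) (z : BiTrunc k a ⊗[k] BiTrunc k b) :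
    twistMap q a b i j ((biDiff k a i).rTensor _ z) =
      twistMap q a b (i + 1) j z * coeffX q a b i j := by
  suffices h : twistMap q a b i j ∘ₗ (biDiff k a i).rTensor _ =
      LinearMap.mulRight k (coeffX q a b i j) ∘ₗ twistMap q a b (i + 1) j from
    LinearMap.congr_fun h z
  refine biTrunc_tensor_ext fun u u' v v' _ _ _ _ => ?_
  rw [LinearMap.comp_apply, LinearMap.comp_apply, LinearMap.rTensor_tmul, biDiff_biPow,
    twistMap_tmul, LinearMap.mulRight_apply, ← LinearMap.mulLeft_apply k, coeffX, map_diffSum,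
    ← TensorProduct.mk_apply, ← LinearMap.flip_apply, map_diffSum, map_diffSum]
  refine diffSum_congr fun t s hts => ?_
  rw [LinearMap.flip_apply, TensorProduct.mk_apply, twistMap_tmul, LinearMap.mulLeft_apply,
    smul_mul_smul_comm, biMonomial_mul_X, smul_smul, ← pow_add, ← pow_add]
  congr 2
  rw [twistExp, twistExp, genDeg_succ ha, ← hts]
  ring

/-- Here it is the left factor `Y ^ t` that is passed by the generator of `X`-degree `genDeg a i`,
so the twist involves `t` instead of `s`. -/
theorem twistMap_lTensor_biDiff (hb : 0 < b) (i j : ℕ) (z : BiTrunc k a ⊗[k] BiTrunc k b) :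
    twistMap q a b i j ((biDiff k b j).lTensor _ z) =
      twistMap q a b i (j + 1) z * coeffY q a b i j := by
  suffices h : twistMap q a b i j ∘ₗ (biDiff k b j).lTensor _ =
      LinearMap.mulRight k (coeffY q a b i j) ∘ₗ twistMap q a b i (j + 1) from
    LinearMap.congr_fun h z
  refine biTrunc_tensor_ext fun u u' v v' _ _ _ _ => ?_
  rw [LinearMap.comp_apply, LinearMap.comp_apply, LinearMap.lTensor_tmul, biDiff_biPow,
    twistMap_tmul, LinearMap.mulRight_apply, ← LinearMap.mulLeft_apply k, coeffY, map_diffSum,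
    ← TensorProduct.mk_apply, map_diffSum, map_diffSum]
  refine diffSum_congr fun t s hts => ?_
  rw [TensorProduct.mk_apply, twistMap_tmul, LinearMap.mulLeft_apply,
    smul_mul_smul_comm, biMonomial_mul_Y, smul_smul, ← pow_add, ← pow_add]
  congr 2
  rw [twistExp, twistExp, genDeg_succ hb, ← hts]
  ring

variable {q} (hq : q ≠ 0) (ha : 0 < a) (hb : 0 < b)

variable (q) in
/-- The basis of the enveloping algebra that consists of tensor products of monomials. -/
def biMonomialBasis :
    Module.Basis ((Fin b × Fin a) × (Fin b × Fin a)) k (Enveloping k (QuantumCI q a b)) :=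
  (monomialBasis q ha hb).tensorProduct
    ((monomialBasis q ha hb).map (MulOpposite.opLinearEquiv k))

theorem biMonomialBasis_apply (p : (Fin b × Fin a) × (Fin b × Fin a)) :
    biMonomialBasis q ha hb p = biMonomial q a b p.1.2 p.2.2 p.1.1 p.2.1 := by
  rw [biMonomialBasis, Module.Basis.tensorProduct_apply, Module.Basis.map_apply,
    monomialBasis_apply, monomialBasis_apply]
  rfl

/-- `twistMap` as a linear equivalence. -/
def twist (i j : ℕ) : (BiTrunc k a ⊗[k] BiTrunc k b) ≃ₗ[k] Enveloping k (QuantumCI q a b) :=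
  LinearEquiv.ofLinearMap (twistMap q a b i j)
    ((biMonomialBasis q ha hb).constr k fun p =>
      (q ^ twistExp a b i j p.1.2 p.2.2 p.1.1 p.2.1)⁻¹ •
        (biPow k a p.1.2 p.2.2 ⊗ₜ biPow k b p.1.1 p.2.1))
    ((biMonomialBasis q ha hb).ext fun p => by
      rw [LinearMap.comp_apply, Module.Basis.constr_basis, map_smul, twistMap_tmul, smul_smul,
        inv_mul_cancel₀ (pow_ne_zero _ hq), one_smul, LinearMap.id_apply, biMonomialBasis_apply])
    (biTrunc_tensor_ext fun u u' v v' hu hu' hv hv' => by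
      rw [LinearMap.comp_apply, twistMap_tmul, map_smul,
        ← biMonomialBasis_apply ha hb ((⟨v, hv⟩, ⟨u, hu⟩), (⟨v', hv'⟩, ⟨u', hu'⟩)),
        Module.Basis.constr_basis, smul_smul, mul_inv_cancel₀ (pow_ne_zero _ hq), one_smul,
        LinearMap.id_apply])

theorem twist_rTensor_biDiff (i j : ℕ) (z : BiTrunc k a ⊗[k] BiTrunc k b) :
    twist hq ha hb i j ((biDiff k a i).rTensor _ z) =
      twist hq ha hb (i + 1) j z * coeffX q a b i j :=
  twistMap_rTensor_biDiff q ha i j z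

theorem twist_lTensor_biDiff (i j : ℕ) (z : BiTrunc k a ⊗[k] BiTrunc k b) :
    twist hq ha hb i j ((biDiff k b j).lTensor _ z) =
      twist hq ha hb i (j + 1) z * coeffY q a b i j :=
  twistMap_lTensor_biDiff q hb i j z

variable (q a b) in
/-- The right multiplication by `coeffX`. -/
def resX (i j : ℕ) : Enveloping k (QuantumCI q a b) →ₗ[Enveloping k (QuantumCI q a b)]
    Enveloping k (QuantumCI q a b) :=
  LinearMap.toSpanSingleton _ _ (coeffX q a b i j)

variable (q a b) in
/-- The right multiplication by `coeffY`. -/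
def resY (i j : ℕ) : Enveloping k (QuantumCI q a b) →ₗ[Enveloping k (QuantumCI q a b)]
    Enveloping k (QuantumCI q a b) :=
  LinearMap.toSpanSingleton _ _ (coeffY q a b i j)

theorem resX_twist (i j : ℕ) (z : BiTrunc k a ⊗[k] BiTrunc k b) :
    resX q a b i j (twist hq ha hb (i + 1) j z) =
      twist hq ha hb i j ((biDiff k a i).rTensor _ z) :=
  (twist_rTensor_biDiff hq ha hb i j z).symm

theorem resY_twist (i j : ℕ) (z : BiTrunc k a ⊗[k] BiTrunc k b) :
    resY q a b i j (twist hq ha hb i (j + 1) z) =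
      twist hq ha hb i j ((biDiff k b j).lTensor _ z) :=
  (twist_lTensor_biDiff hq ha hb i j z).symm

/-- The contracting homotopy from position `(i, j)` to position `(i + 1, j)`. -/
def resS (i j : ℕ) : Enveloping k (QuantumCI q a b) →ₗ[k] Enveloping k (QuantumCI q a b) :=
  (twist hq ha hb (i + 1) j).toLinearMap ∘ₗ (biHtpy k a i).rTensor _ ∘ₗ
    (twist hq ha hb i j).symm.toLinearMap

/-- The contracting homotopy from position `(0, j)` to position `(0, j + 1)`. -/
def resT (j : ℕ) : Enveloping k (QuantumCI q a b) →ₗ[k] Enveloping k (QuantumCI q a b) :=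
  (twist hq ha hb 0 (j + 1)).toLinearMap ∘ₗ (biHtpy k b j).lTensor _ ∘ₗ (biProj k a).rTensor _ ∘ₗ
    (twist hq ha hb 0 j).symm.toLinearMap

/-- The projection to a complement of the image of the differential. -/
def resP : ℕ → ℕ → Enveloping k (QuantumCI q a b) →ₗ[k] Enveloping k (QuantumCI q a b)
  | 0, 0 => (twist hq ha hb 0 0).toLinearMap ∘ₗ (biProj k b).lTensor _ ∘ₗ (biProj k a).rTensor _ ∘ₗ
    (twist hq ha hb 0 0).symm.toLinearMap
  | _, _ => 0

theorem resS_twist (i j : ℕ) (z : BiTrunc k a ⊗[k] BiTrunc k b) :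
    resS hq ha hb i j (twist hq ha hb i j z) =
      twist hq ha hb (i + 1) j ((biHtpy k a i).rTensor _ z) := by
  simp [resS]

theorem resT_twist (j : ℕ) (z : BiTrunc k a ⊗[k] BiTrunc k b) :
    resT hq ha hb j (twist hq ha hb 0 j z) =
      twist hq ha hb 0 (j + 1) ((biHtpy k b j).lTensor _ ((biProj k a).rTensor _ z)) := by
  simp [resT]

theorem resP_twist (z : BiTrunc k a ⊗[k] BiTrunc k b) :
    resP hq ha hb 0 0 (twist hq ha hb 0 0 z) =
      twist hq ha hb 0 0 ((biProj k b).lTensor _ ((biProj k a).rTensor _ z)) := by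
  simp [resP]

theorem lTensor_rTensor_comm {k U V : Type*} [Field k] [AddCommGroup U] [Module k U]
    [AddCommGroup V] [Module k V] (f : U →ₗ[k] U) (g : V →ₗ[k] V) (z : U ⊗[k] V) :
    g.lTensor U (f.rTensor V z) = f.rTensor V (g.lTensor U z) := by
  rw [← LinearMap.comp_apply, ← LinearMap.comp_apply, LinearMap.lTensor_comp_rTensor,
    LinearMap.rTensor_comp_lTensor]

theorem rTensor_add_comp {k U V : Type*} [Field k] [AddCommGroup U] [Module k U]
    [AddCommGroup V] [Module k V] {f g f' g' : U →ₗ[k] U} (h : ∀ x, f (g x) + f' (g' x) = x)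
    (z : U ⊗[k] V) :
    f.rTensor V (g.rTensor V z) + f'.rTensor V (g'.rTensor V z) = z := by
  rw [← LinearMap.rTensor_comp_apply, ← LinearMap.rTensor_comp_apply, ← LinearMap.add_apply,
    ← LinearMap.rTensor_add, show f ∘ₗ g + f' ∘ₗ g' = LinearMap.id from LinearMap.ext h,
    LinearMap.rTensor_id, LinearMap.id_apply]

theorem lTensor_add_comp {k U V : Type*} [Field k] [AddCommGroup U] [Module k U]
    [AddCommGroup V] [Module k V] {f g f' g' : V →ₗ[k] V} (h : ∀ x, f (g x) + f' (g' x) = x)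
    (z : U ⊗[k] V) :
    f.lTensor U (g.lTensor U z) + f'.lTensor U (g'.lTensor U z) = z := by
  rw [← LinearMap.lTensor_comp_apply, ← LinearMap.lTensor_comp_apply, ← LinearMap.add_apply,
    ← LinearMap.lTensor_add, show f ∘ₗ g + f' ∘ₗ g' = LinearMap.id from LinearMap.ext h,
    LinearMap.lTensor_id, LinearMap.id_apply]

-- Since `twist` is bijective and intertwines the differentials, this and the following identities
-- reduce to untwisted ones on the two tensor factors.
include hq ha hb in
theorem resX_resX (i j : ℕ) (z : Enveloping k (QuantumCI q a b)) :
    resX q a b i j (resX q a b (i + 1) j z) = 0 := by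
  obtain ⟨w, rfl⟩ := (twist hq ha hb (i + 1 + 1) j).surjective z
  rw [resX_twist, resX_twist, ← LinearMap.rTensor_comp_apply,
    show biDiff k a i ∘ₗ biDiff k a (i + 1) = 0 from LinearMap.ext (biDiff_biDiff k a i),
    LinearMap.rTensor_zero, LinearMap.zero_apply, map_zero]

include hq ha hb in
theorem resY_resY (i j : ℕ) (z : Enveloping k (QuantumCI q a b)) :
    resY q a b i j (resY q a b i (j + 1) z) = 0 := by
  obtain ⟨w, rfl⟩ := (twist hq ha hb i (j + 1 + 1)).surjective z
  rw [resY_twist, resY_twist, ← LinearMap.lTensor_comp_apply,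
    show biDiff k b j ∘ₗ biDiff k b (j + 1) = 0 from LinearMap.ext (biDiff_biDiff k b j),
    LinearMap.lTensor_zero, LinearMap.zero_apply, map_zero]

include hq ha hb in
theorem resX_resY (i j : ℕ) (z : Enveloping k (QuantumCI q a b)) :
    resX q a b i j (resY q a b (i + 1) j z) = resY q a b i j (resX q a b i (j + 1) z) := by
  obtain ⟨w, rfl⟩ := (twist hq ha hb (i + 1) (j + 1)).surjective z
  rw [resX_twist, resY_twist, resX_twist, resY_twist, lTensor_rTensor_comm]

theorem resX_resS (i j : ℕ) (z : Enveloping k (QuantumCI q a b)) :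
    resX q a b (i + 1) j (resS hq ha hb (i + 1) j z) + resS hq ha hb i j (resX q a b i j z) +
      resP hq ha hb (i + 1) j z = z := by
  obtain ⟨w, rfl⟩ := (twist hq ha hb (i + 1) j).surjective z
  rw [resX_twist, resS_twist, resS_twist, resX_twist, ← map_add, add_comm (LinearMap.rTensor _ _ _),
    rTensor_add_comp (biHtpy_biDiff_add k a i)]
  exact add_zero _

theorem resY_resS (i j : ℕ) (z : Enveloping k (QuantumCI q a b)) :
    resY q a b (i + 1) j (resS hq ha hb i (j + 1) z) = resS hq ha hb i j (resY q a b i j z) := by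
  obtain ⟨w, rfl⟩ := (twist hq ha hb i (j + 1)).surjective z
  rw [resY_twist, resS_twist, resS_twist, resY_twist, lTensor_rTensor_comm]

/-- At `i = 0` the `X`-homotopy leaves the defect `biProj`; on its image the `Y`-homotopy takes
over. -/
theorem resX_resS_zero (j : ℕ) (z : Enveloping k (QuantumCI q a b)) :
    resX q a b 0 (j + 1) (resS hq ha hb 0 (j + 1) z) +
      resY q a b 0 (j + 1) (resT hq ha hb (j + 1) z) + resT hq ha hb j (resY q a b 0 j z) +
      resP hq ha hb 0 (j + 1) z = z := by
  obtain ⟨w, rfl⟩ := (twist hq ha hb 0 (j + 1)).surjective z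
  rw [resS_twist, resX_twist, resT_twist, resY_twist, resY_twist, resT_twist, add_assoc, add_assoc]
  nth_rw 2 [← add_assoc]
  rw [← lTensor_rTensor_comm, ← map_add (twist hq ha hb 0 (j + 1)),
    add_comm (LinearMap.lTensor _ _ _), lTensor_add_comp (biHtpy_biDiff_add k b j)]
  have h := rTensor_add_comp (V := BiTrunc k b) (f := biDiff k a 0) (g := biHtpy k a 0)
    (f' := biProj k a) (g' := LinearMap.id) (biDiff_biHtpy_zero k a) w
  rw [LinearMap.rTensor_id, LinearMap.id_apply] at h
  refine Eq.trans ?_ (congrArg _ h)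
  rw [map_add]
  exact congrArg _ (add_zero _)

theorem resT_resX (j : ℕ) (z : Enveloping k (QuantumCI q a b)) :
    resT hq ha hb j (resX q a b 0 j z) = 0 := by
  obtain ⟨w, rfl⟩ := (twist hq ha hb (0 + 1) j).surjective z
  rw [resX_twist, resT_twist, ← LinearMap.rTensor_comp_apply,
    show biProj k a ∘ₗ biDiff k a 0 = 0 from LinearMap.ext (biProj_biDiff k a),
    LinearMap.rTensor_zero, LinearMap.zero_apply, map_zero, map_zero]

theorem resX_resS_zero_zero (z : Enveloping k (QuantumCI q a b)) :
    resX q a b 0 0 (resS hq ha hb 0 0 z) + resY q a b 0 0 (resT hq ha hb 0 z) +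
      resP hq ha hb 0 0 z = z := by
  obtain ⟨w, rfl⟩ := (twist hq ha hb 0 0).surjective z
  rw [resS_twist, resX_twist, resT_twist, resY_twist, resP_twist, add_assoc, ← map_add, ← map_add]
  congr 1
  have h := rTensor_add_comp (V := BiTrunc k b) (f := biDiff k a 0) (g := biHtpy k a 0)
    (f' := biProj k a) (g' := LinearMap.id) (biDiff_biHtpy_zero k a) w
  have h' := lTensor_add_comp (U := BiTrunc k a) (f := biDiff k b 0) (g := biHtpy k b 0)
    (f' := biProj k b) (g' := LinearMap.id) (biDiff_biHtpy_zero k b) ((biProj k a).rTensor _ w)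
  rw [LinearMap.lTensor_id, LinearMap.id_apply] at h'
  rw [LinearMap.rTensor_id, LinearMap.id_apply] at h
  rw [h', h]

end Resolution

/-! ### Exactness of the bimodule resolution -/

section Exactness

variable {k : Type u} [Field k] (q : k) (a b : ℕ)

/-- The augmentation of the bimodule resolution. -/
def augmentation : Enveloping k (QuantumCI q a b) →ₗ[k] QuantumCI q a b :=
  LinearMap.applyₗ 1 ∘ₗ (AlgHom.mulLeftRight k (QuantumCI q a b)).toLinearMap

theorem augmentation_tmul (x y : QuantumCI q a b) : augmentation q a b (x ⊗ₜ op y) = x * y := by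
  change AlgHom.mulLeftRight k _ (x ⊗ₜ op y) 1 = _
  rw [AlgHom.mulLeftRight_apply, mul_one, unop_op]

theorem augmentation_mul (x y : Enveloping k (QuantumCI q a b)) :
    augmentation q a b (x * y) =
      AlgHom.mulLeftRight k (QuantumCI q a b) x (augmentation q a b y) := by
  change AlgHom.mulLeftRight k _ (x * y) 1 = _
  rw [map_mul]
  rfl

theorem augmentation_resX (z : Enveloping k (QuantumCI q a b)) :
    augmentation q a b (resX q a b 0 0 z) = 0 := by
  change augmentation q a b (z * coeffX q a b 0 0) = 0
  rw [augmentation_mul, coeffX, map_diffSum, diffSum_of_even Even.zero]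
  simp only [map_smul, augmentation_tmul, monomial_zero_zero, one_mul, mul_one]
  simp [genDeg]

theorem augmentation_resY (z : Enveloping k (QuantumCI q a b)) :
    augmentation q a b (resY q a b 0 0 z) = 0 := by
  change augmentation q a b (z * coeffY q a b 0 0) = 0
  rw [augmentation_mul, coeffY, map_diffSum, diffSum_of_even Even.zero]
  simp only [map_smul, augmentation_tmul, monomial_zero_zero, one_mul, mul_one]
  simp [genDeg]

theorem augmentation_surjective : Function.Surjective (augmentation q a b) := fun x =>
  ⟨x ⊗ₜ op 1, by rw [augmentation_tmul, mul_one]⟩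

variable {q a b} (hq : q ≠ 0) (ha : 0 < a) (hb : 0 < b)

/-- In twisted coordinates the augmentation is multiplication in both factors, so the projection
factors through it. -/
theorem resP_of_augmentation_eq_zero (z : Enveloping k (QuantumCI q a b))
    (hz : augmentation q a b z = 0) : resP hq ha hb 0 0 z = 0 := by
  obtain ⟨w, rfl⟩ := (twist hq ha hb 0 0).surjective z
  -- The element `X ^ u * Y ^ v = q ^ (u * v) • (Y ^ v * X ^ u)` should go to `(1 ⊗ x ^ u) ⊗ (1 ⊗ y
  -- ^ v)`, whence the inverse power of `q`.
  let σ : QuantumCI q a b →ₗ[k] BiTrunc k a ⊗[k] BiTrunc k b :=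
    (monomialBasis q ha hb).constr k fun p =>
      (q ^ ((p.2 : ℕ) * p.1))⁻¹ • (biPow k a 0 p.2 ⊗ₜ biPow k b 0 p.1)
  have hσ (v u : ℕ) : σ (q ^ (u * v) • monomial q a b v u) = biPow k a 0 u ⊗ₜ biPow k b 0 v := by
    by_cases h : b ≤ v ∨ a ≤ u
    · rw [monomial_eq_zero q h, smul_zero, map_zero]
      rcases h with h | h
      · rw [biPow_of_le k (Or.inr h), tmul_zero]
      · rw [biPow_of_le k (Or.inr h), zero_tmul]
    · rw [map_smul, ← monomialBasis_apply q ha hb (⟨v, by omega⟩, ⟨u, by omega⟩),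
        Module.Basis.constr_basis, smul_smul, mul_inv_cancel₀ (pow_ne_zero _ hq), one_smul]
  have key : σ ∘ₗ augmentation q a b ∘ₗ (twist hq ha hb 0 0).toLinearMap =
      (biProj k b).lTensor _ ∘ₗ (biProj k a).rTensor _ :=
    biTrunc_tensor_ext fun u u' v v' _ _ _ _ => by
      rw [LinearMap.comp_apply, LinearMap.comp_apply, LinearMap.comp_apply, LinearMap.rTensor_tmul,
        LinearMap.lTensor_tmul, biProj_biPow, biProj_biPow, ← hσ]
      change σ (augmentation q a b (twistMap q a b 0 0 _)) = _
      rw [twistMap_tmul, map_smul, biMonomial, augmentation_tmul, monomial_mul_monomial, smul_smul,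
        ← pow_add]
      congr 3
      rw [twistExp, genDeg, genDeg]
      ring
  have := LinearMap.congr_fun key w
  simp only [LinearMap.comp_apply, LinearEquiv.coe_coe, hz, map_zero] at this
  rw [resP_twist, ← this, map_zero]

variable (q a b) in
/-- The differential of the bimodule resolution. -/
def resDiff (n : ℕ) : (Idx (n + 1) → Enveloping k (QuantumCI q a b))
    →ₗ[Enveloping k (QuantumCI q a b)] (Idx n → Enveloping k (QuantumCI q a b)) :=
  totalDiff (resX q a b) (resY q a b) n

-- The defect `resP` lives only at `(0, 0)`, so in positive degrees the homotopy is a contraction.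
include hq ha hb in
theorem resDiff_exact (n : ℕ) :
    Function.Exact (resDiff q a b (n + 1)) (resDiff q a b n) := by
  intro f
  constructor
  · intro hf
    have h := totalDiff_totalHtpy (resX q a b) (resY q a b) (resS hq ha hb) (resT hq ha hb)
      (resP hq ha hb) (resX_resS hq ha hb) (resY_resS hq ha hb) (resX_resS_zero hq ha hb)
      (resT_resX hq ha hb) (resX_resS_zero_zero hq ha hb) n f
    have hP : diagIdx (resP hq ha hb) (n + 1) f = 0 := by
      ext ⟨⟨i, j⟩, hij⟩
      rw [diagIdx_apply]
      rw [Finset.HasAntidiagonal.mem_antidiagonal] at hij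
      rcases i with _ | i
      · rcases j with _ | j
        · simp at hij
        · rfl
      · rfl
    have hf' : totalDiff (resX q a b) (resY q a b) n f = 0 := hf
    rw [hP, add_zero, hf', map_zero, add_zero] at h
    exact ⟨totalHtpy (resS hq ha hb) (resT hq ha hb) (n + 1) f, h⟩
  · rintro ⟨g, rfl⟩
    exact totalDiff_totalDiff (resX q a b) (resY q a b) (resX_resX hq ha hb) (resY_resY hq ha hb)
      (resX_resY hq ha hb) n g

/-- The unique index in degree `0`. -/
def idxZero : Idx 0 := ⟨(0, 0), by simp⟩

theorem idx_zero_eq (p : Idx 0) : p = idxZero := by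
  obtain ⟨⟨i, j⟩, hij⟩ := p
  obtain ⟨rfl, rfl⟩ : i = 0 ∧ j = 0 := by simpa using hij
  rfl

include hq ha hb in
theorem resDiff_exact_augmentation :
    Function.Exact (resDiff q a b 0) fun f => augmentation q a b (f idxZero) := by
  intro f
  constructor
  · intro hf
    have h := totalDiff_totalHtpy_zero (resX q a b) (resY q a b) (resS hq ha hb) (resT hq ha hb)
      (resP hq ha hb) (resX_resS hq ha hb) (resY_resS hq ha hb) (resX_resS_zero hq ha hb)
      (resT_resX hq ha hb) (resX_resS_zero_zero hq ha hb) f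
    have hP : diagIdx (resP hq ha hb) 0 f = 0 := by
      ext p
      rw [diagIdx_apply, idx_zero_eq p]
      exact resP_of_augmentation_eq_zero hq ha hb _ hf
    rw [hP, add_zero] at h
    exact ⟨totalHtpy (resS hq ha hb) (resT hq ha hb) 0 f, h⟩
  · rintro ⟨g, rfl⟩
    change augmentation q a b (resX q a b 0 0 _ + (-1 : ℤ) ^ 0 • resY q a b 0 0 _) = 0
    rw [map_add, map_zsmul, augmentation_resX, augmentation_resY]
    simp

end Exactness

/-! ### The complex that computes the Hochschild homology -/

section HochschildComplex

variable {k : Type u} [Field k]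

/-- The coefficient of the differential in the direction of `X`. -/
def scalarX (a i : ℕ) (Q : k) : k := diffSum k a i fun _ s => Q ^ s

/-- The coefficient of the differential in the direction of `Y`. -/
def scalarY (b j : ℕ) (Q : k) : k := diffSum k b j fun t _ => Q ^ t

theorem scalarX_one_of_even (a : ℕ) {i : ℕ} (hi : Even i) : scalarX a i (1 : k) = 0 := by
  simp [scalarX, diffSum_of_even hi]

theorem scalarY_one_of_even (b : ℕ) {j : ℕ} (hj : Even j) : scalarY b j (1 : k) = 0 := by
  simp [scalarY, diffSum_of_even hj]

theorem scalarX_one_of_not_even {a i : ℕ} (ha : 0 < a) (hi : ¬ Even i) :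
    scalarX a i (1 : k) = a := by
  simp [scalarX, diffSum_of_not_even ha hi]

theorem scalarY_one_of_not_even {b j : ℕ} (hb : 0 < b) (hj : ¬ Even j) :
    scalarY b j (1 : k) = b := by
  simp [scalarY, diffSum_of_not_even hb hj]

theorem geom_sum_ne_zero_of_pow_ne_one {a : ℕ} {Q : k} (h : Q ^ a ≠ 1) :
    ∑ t ∈ Finset.range a, Q ^ t ≠ 0 := fun h' => h <| by
  have := geom_sum_mul Q a
  rw [h', zero_mul] at this
  exact (sub_eq_zero.1 this.symm)

/-- The scalar is `1 - Q` or the geometric sum, whose product with `Q - 1` is `Q ^ a - 1`. -/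
theorem scalarX_ne_zero {a i : ℕ} (ha : 0 < a) {Q : k} (h₁ : Q ≠ 1) (h : Q ^ a ≠ 1) :
    scalarX a i Q ≠ 0 := by
  by_cases hi : Even i
  · rw [scalarX, diffSum_of_even hi, pow_zero, pow_one]
    exact sub_ne_zero.2 h₁.symm
  · rw [scalarX, diffSum_of_not_even ha hi, Finset.sum_range_reflect (fun t => Q ^ t)]
    exact geom_sum_ne_zero_of_pow_ne_one h

theorem diffSum_smul_const {M : Type*} [AddCommGroup M] [Module k M] (a i : ℕ) (f : ℕ → ℕ → k)
    (m : M) : (diffSum k a i fun t s => f t s • m) = diffSum k a i f • m :=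
  (map_diffSum (LinearMap.toSpanSingleton k M m) a i f).symm

theorem gap_add_gap_succ {a : ℕ} (ha : 0 < a) (i : ℕ) : gap a i + gap a (i + 1) = a := by
  by_cases hi : Even i
  · rw [gap_of_even hi, gap_of_not_even (by rwa [Nat.even_add_one, not_not])]
    omega
  · rw [gap_of_not_even hi, gap_of_even (by rwa [Nat.even_add_one])]
    omega

theorem gap_pos {a : ℕ} (ha : 2 ≤ a) (i : ℕ) : 0 < gap a i := by
  rw [gap]
  split_ifs <;> omega

theorem genDeg_succ_pos {a : ℕ} (ha : 0 < a) (i : ℕ) : 0 < genDeg a (i + 1) := by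
  rw [genDeg]
  rcases Nat.even_or_odd' i with ⟨m, rfl | rfl⟩
  · omega
  · rw [show (2 * m + 1 + 1) / 2 = m + 1 by omega]
    positivity

theorem genDeg_zero (a : ℕ) : genDeg a 0 = 0 := by simp [genDeg]

variable (q : k) (a b : ℕ)

/-- The action of `coeffX` on the right module `A`. -/
def homX (i j : ℕ) : QuantumCI q a b →ₗ[k] QuantumCI q a b :=
  AlgHom.mulLeftRight k _ (envelopingSwap k _ (op (coeffX q a b i j)))

/-- The action of `coeffY` on the right module `A`. -/
def homY (i j : ℕ) : QuantumCI q a b →ₗ[k] QuantumCI q a b :=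
  AlgHom.mulLeftRight k _ (envelopingSwap k _ (op (coeffY q a b i j)))

/-- The right action of the enveloping algebra on an element of `A`. -/
def rightActionOn (z : QuantumCI q a b) :
    Enveloping k (QuantumCI q a b) →ₗ[k] QuantumCI q a b :=
  LinearMap.applyₗ z ∘ₗ (AlgHom.mulLeftRight k (QuantumCI q a b)).toLinearMap ∘ₗ
    (envelopingSwap k (QuantumCI q a b)).toLinearMap ∘ₗ
      (MulOpposite.opLinearEquiv k).toLinearMap

theorem rightActionOn_tmul (z x y : QuantumCI q a b) :
    rightActionOn q a b z (x ⊗ₜ op y) = y * z * x := by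
  change AlgHom.mulLeftRight k _ (envelopingSwap k _ (op (x ⊗ₜ op y))) z = _
  rw [envelopingSwap_tmul, AlgHom.mulLeftRight_apply, unop_op]

/-- Moving `X ^ s` past `Y ^ v` gives `q ^ (s * v)`, which joins the twist `q ^ (genDeg b j * s)`
already in `coeffX`. The coefficients are therefore powers of the single number `q ^ (genDeg b j +
v)`. -/
theorem homX_monomial (i j v u : ℕ) :
    homX q a b i j (monomial q a b v u) =
      scalarX a i (q ^ (genDeg b j + v)) • monomial q a b v (u + gap a i) := by
  change rightActionOn q a b _ (coeffX q a b i j) = _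
  rw [coeffX, map_diffSum]
  refine (diffSum_congr fun t s hts => ?_).trans
    (diffSum_smul_const a i (fun _ s => (q ^ (genDeg b j + v)) ^ s) _)
  rw [map_smul, rightActionOn_tmul, monomial_mul_monomial, smul_mul_assoc, monomial_mul_monomial,
    mul_zero, pow_zero, one_smul, smul_smul, ← pow_add, ← pow_mul, ← hts]
  congr 1
  · ring
  · congr 1 <;> ring

theorem homY_monomial (i j v u : ℕ) :
    homY q a b i j (monomial q a b v u) =
      scalarY b j (q ^ (genDeg a i + u)) • monomial q a b (v + gap b j) u := by
  change rightActionOn q a b _ (coeffY q a b i j) = _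
  rw [coeffY, map_diffSum]
  refine (diffSum_congr fun t s hts => ?_).trans
    (diffSum_smul_const b j (fun t _ => (q ^ (genDeg a i + u)) ^ t) _)
  rw [map_smul, rightActionOn_tmul, monomial_mul_monomial, smul_mul_assoc, monomial_mul_monomial,
    zero_mul, pow_zero, one_smul, smul_smul, ← pow_add, ← pow_mul, ← hts]
  congr 1
  · ring
  · congr 1 <;> ring

variable {a b}

section Lift

variable {M : Type*} [AddCommGroup M] [Module k M]

/-- The linear map with given values on the monomials. -/
def monomialLift (ha : 0 < a) (hb : 0 < b) (f : ℕ → ℕ → M) : QuantumCI q a b →ₗ[k] M :=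
  (monomialBasis q ha hb).constr k fun p => f p.1 p.2

theorem monomialLift_monomial (ha : 0 < a) (hb : 0 < b) (f : ℕ → ℕ → M) {v u : ℕ} (hv : v < b)
    (hu : u < a) : monomialLift q ha hb f (monomial q a b v u) = f v u := by
  rw [← monomialBasis_apply q ha hb (⟨v, hv⟩, ⟨u, hu⟩), monomialLift, Module.Basis.constr_basis]

theorem monomial_ext (ha : 0 < a) (hb : 0 < b) {φ ψ : QuantumCI q a b →ₗ[k] M}
    (h : ∀ v u, v < b → u < a → φ (monomial q a b v u) = ψ (monomial q a b v u)) : φ = ψ :=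
  (monomialBasis q ha hb).ext fun p => by
    rw [monomialBasis_apply]
    exact h _ _ p.1.2 p.2.2

end Lift

/-- The exponent of the monomial in the `i`-th term of the Hochschild complex of `k[x] / (x ^ a)`
that contributes to the homology only if `a = 0` in `k`. -/
def exceptional (a i : ℕ) : ℕ := if Even i then 0 else a - 1

variable (k a b) in
/-- The monomials at position `(i, j)` that represent a basis of the homology. -/
def Survives (i j v u : ℕ) : Prop :=
  match i, j with
  | 0, 0 => u = 0 ∨ v = 0
  | 0, j + 1 => u = 0 ∧ (v ≠ exceptional b (j + 1) ∨ (b : k) = 0)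
  | i + 1, j => j = 0 ∧ v = 0 ∧ (u ≠ exceptional a (i + 1) ∨ (a : k) = 0)

variable (ha : 0 < a) (hb : 0 < b)

/-- The homotopy from position `(i, j)` to position `(i + 1, j)`. -/
def homS (i j : ℕ) : QuantumCI q a b →ₗ[k] QuantumCI q a b :=
  monomialLift q ha hb fun v u =>
    if gap a i ≤ u then
      (scalarX a i (q ^ (genDeg b j + v)))⁻¹ • monomial q a b v (u - gap a i) else 0

/-- The homotopy from position `(0, j)` to position `(0, j + 1)`. -/
def homT (j : ℕ) : QuantumCI q a b →ₗ[k] QuantumCI q a b :=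
  monomialLift q ha hb fun v u =>
    if u = 0 ∧ gap b j ≤ v then
      (scalarY b j (1 : k))⁻¹ • monomial q a b (v - gap b j) 0 else 0

open scoped Classical in
/-- The projection to the span of the monomials that survive at position `(i, j)`. -/
def homP (i j : ℕ) : QuantumCI q a b →ₗ[k] QuantumCI q a b :=
  monomialLift q ha hb fun v u => if Survives k a b i j v u then monomial q a b v u else 0

theorem homS_monomial (i j : ℕ) {v u : ℕ} (hu : u < a) :
    homS q ha hb i j (monomial q a b v u) = if gap a i ≤ u then
      (scalarX a i (q ^ (genDeg b j + v)))⁻¹ • monomial q a b v (u - gap a i) else 0 := by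
  by_cases hv : v < b
  · exact monomialLift_monomial q ha hb _ hv hu
  · rw [monomial_eq_zero q (by omega), monomial_eq_zero q (by omega)]
    simp

theorem homT_monomial (j : ℕ) {v u : ℕ} (hv : v < b) :
    homT q ha hb j (monomial q a b v u) = if u = 0 ∧ gap b j ≤ v then
      (scalarY b j (1 : k))⁻¹ • monomial q a b (v - gap b j) 0 else 0 := by
  by_cases hu : u < a
  · exact monomialLift_monomial q ha hb _ hv hu
  · rw [monomial_eq_zero q (by omega), if_neg (by omega), map_zero]

open scoped Classical in
theorem homP_monomial (i j v u : ℕ) :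
    homP q ha hb i j (monomial q a b v u) =
      if Survives k a b i j v u then monomial q a b v u else 0 := by
  by_cases h : b ≤ v ∨ a ≤ u
  · rw [monomial_eq_zero q h]
    simp
  · exact monomialLift_monomial q ha hb _ (by omega) (by omega)

/-- As `0⁻¹ = 0`, the homotopy vanishes exactly where the scalar of the differential does, and there
the projection takes over. -/
theorem inv_mul_smul_add_ite {k M : Type*} [Field k] [AddCommGroup M] [Module k M] (c : k) (m : M)
    (p : Prop) {_ : Decidable p} (h : p ↔ c = 0) : (c⁻¹ * c) • m + (if p then m else 0) = m := by
  by_cases hc : c = 0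
  · rw [if_pos (h.2 hc), hc, mul_zero, zero_smul, zero_add]
  · rw [if_neg (fun hp => hc (h.1 hp)), inv_mul_cancel₀ hc, one_smul, add_zero]

variable (hq : ∀ m : ℕ, 0 < m → q ^ m ≠ 1)

-- Here it matters that `q` is not a root of unity: for `m > 0` neither `q ^ m` nor `q ^ (m * a)` is
-- `1`.
include hq ha in
theorem scalarX_pow_eq_zero_iff (i m : ℕ) :
    scalarX a i (q ^ m) = 0 ↔ m = 0 ∧ (Even i ∨ (a : k) = 0) := by
  rcases Nat.eq_zero_or_pos m with rfl | hm
  · rw [pow_zero]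
    by_cases hi : Even i
    · simp [scalarX_one_of_even a hi, hi]
    · simp [scalarX_one_of_not_even ha hi, hi]
  · simp only [hm.ne', false_and, iff_false]
    exact scalarX_ne_zero ha (hq m hm) (by rw [← pow_mul]; exact hq _ (by positivity))

include hb in
theorem scalarY_one_eq_zero_iff (j : ℕ) :
    scalarY b j (1 : k) = 0 ↔ Even j ∨ (b : k) = 0 := by
  by_cases hj : Even j
  · simp [scalarY_one_of_even b hj, hj]
  · simp [scalarY_one_of_not_even hb hj, hj]

end HochschildComplex

/-! ### The homotopy on the Hochschild complex -/

section HochschildHomotopy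

variable {k : Type u} [Field k] {q : k} {a b : ℕ}

theorem genDeg_eq_zero_iff (ha : 0 < a) (i : ℕ) : genDeg a i = 0 ↔ i = 0 := by
  rcases i with _ | i
  · simp [genDeg_zero]
  · simp [(genDeg_succ_pos ha i).ne']

theorem exceptional_of_even {i : ℕ} (hi : Even i) : exceptional a i = 0 := if_pos hi

theorem exceptional_of_not_even {i : ℕ} (hi : ¬ Even i) : exceptional a i = a - 1 := if_neg hi

/-- For odd `i` the bound leaves only `u = a - 1`, the exceptional exponent; for even `i` it
excludes the exceptional exponent `0`. This matches survival with vanishing of the scalar. -/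
theorem ne_exceptional_iff_of_gap_le {i u : ℕ} (hu : u < a) (h : gap a i ≤ u) :
    u ≠ exceptional a i ↔ Even i := by
  by_cases hi : Even i
  · rw [exceptional_of_even hi]
    rw [gap_of_even hi] at h
    simp only [hi, iff_true]
    omega
  · rw [exceptional_of_not_even hi]
    rw [gap_of_not_even hi] at h
    simp only [hi, iff_false]
    omega

theorem ne_exceptional_iff_of_lt_gap {i u : ℕ} (h : u < gap a (i + 1)) :
    u ≠ exceptional a (i + 1) ↔ Even i := by
  by_cases hi : Even i
  · have hi' : ¬ Even (i + 1) := by rwa [Nat.even_add_one, not_not]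
    rw [exceptional_of_not_even hi']
    rw [gap_of_not_even hi'] at h
    simp only [hi, iff_true]
    omega
  · have hi' : Even (i + 1) := by rwa [Nat.even_add_one]
    rw [exceptional_of_even hi']
    rw [gap_of_even hi'] at h
    simp only [hi, iff_false]
    omega

variable (hq : ∀ m : ℕ, 0 < m → q ^ m ≠ 1)

section

variable (ha : 0 < a) (hb : 0 < b)

-- Because `gap a i + gap a (i + 1) = a`, each `X ^ u` either is reached by the incoming shift or
-- stays nonzero under the outgoing shift, never both. Only one of the first two terms is present,
-- and it is the identity unless its scalar vanishes.
include hq in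
theorem homX_homS (i j : ℕ) (z : QuantumCI q a b) :
    homX q a b (i + 1) j (homS q ha hb (i + 1) j z) + homS q ha hb i j (homX q a b i j z) +
      homP q ha hb (i + 1) j z = z := by
  suffices h : homX q a b (i + 1) j ∘ₗ homS q ha hb (i + 1) j +
      homS q ha hb i j ∘ₗ homX q a b i j + homP q ha hb (i + 1) j = LinearMap.id from
    LinearMap.congr_fun h z
  refine monomial_ext q ha hb fun v u hv hu => ?_
  simp only [LinearMap.add_apply, LinearMap.comp_apply, LinearMap.id_apply]
  rw [homS_monomial q ha hb _ _ hu, homX_monomial, map_smul, homP_monomial]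
  have hg := gap_add_gap_succ ha i
  by_cases h : gap a (i + 1) ≤ u
  · rw [if_pos h, map_smul, homX_monomial, smul_smul, Nat.sub_add_cancel h,
      monomial_eq_zero q (by omega : b ≤ v ∨ a ≤ u + gap a i), map_zero, smul_zero, add_zero]
    refine inv_mul_smul_add_ite _ _ _ ?_
    rw [scalarX_pow_eq_zero_iff q ha hq, Survives, ne_exceptional_iff_of_gap_le hu h,
      Nat.add_eq_zero_iff, genDeg_eq_zero_iff hb, and_assoc]
  · rw [if_neg h, map_zero, zero_add, homS_monomial q ha hb _ _ (by omega),
      if_pos (Nat.le_add_left _ _), smul_smul, mul_comm, Nat.add_sub_cancel]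
    refine inv_mul_smul_add_ite _ _ _ ?_
    rw [scalarX_pow_eq_zero_iff q ha hq, Survives, ne_exceptional_iff_of_lt_gap (by omega),
      Nat.add_eq_zero_iff, genDeg_eq_zero_iff hb, and_assoc]

/-- The scalars depend only on the total degrees `genDeg a i + u` and `genDeg b j + v`, which both
maps preserve. -/
theorem homY_homS (i j : ℕ) (z : QuantumCI q a b) :
    homY q a b (i + 1) j (homS q ha hb i (j + 1) z) = homS q ha hb i j (homY q a b i j z) := by
  suffices h : homY q a b (i + 1) j ∘ₗ homS q ha hb i (j + 1) =
      homS q ha hb i j ∘ₗ homY q a b i j from LinearMap.congr_fun h z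
  refine monomial_ext q ha hb fun v u hv hu => ?_
  simp only [LinearMap.comp_apply]
  rw [homS_monomial q ha hb _ _ hu, homY_monomial, map_smul, homS_monomial q ha hb _ _ hu]
  split_ifs with h
  · rw [map_smul, homY_monomial, smul_smul, smul_smul, mul_comm, genDeg_succ ha, genDeg_succ hb,
      show genDeg a i + gap a i + (u - gap a i) = genDeg a i + u by omega,
      show genDeg b j + gap b j + v = genDeg b j + (v + gap b j) by omega]
  · rw [map_zero, smul_zero]

theorem homT_monomial_of_pos (j : ℕ) {v u : ℕ} (hu : 0 < u) :
    homT q ha hb j (monomial q a b v u) = 0 := by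
  by_cases hv : v < b
  · rw [homT_monomial q ha hb _ hv, if_neg (by omega)]
  · rw [monomial_eq_zero q (by omega), map_zero]

theorem homT_homX (j : ℕ) (z : QuantumCI q a b) :
    homT q ha hb j (homX q a b 0 j z) = 0 := by
  suffices h : homT q ha hb j ∘ₗ homX q a b 0 j = 0 from LinearMap.congr_fun h z
  refine monomial_ext q ha hb fun v u hv hu => ?_
  rw [LinearMap.comp_apply, homX_monomial, map_smul, gap_of_even Even.zero,
    homT_monomial_of_pos ha hb j (Nat.succ_pos u), smul_zero, LinearMap.zero_apply]

-- For `u > 0` the total `Y`-degree is positive because of `genDeg b (j + 1)`, so the `X`-scalar is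
-- invertible. For `u = 0` the `Y`-scalars are those at `Q = 1`, and the argument is the
-- one-variable one for `k[y] / (y ^ b)`.
include hq in
theorem homX_homS_zero (j : ℕ) (z : QuantumCI q a b) :
    homX q a b 0 (j + 1) (homS q ha hb 0 (j + 1) z) +
      homY q a b 0 (j + 1) (homT q ha hb (j + 1) z) + homT q ha hb j (homY q a b 0 j z) +
      homP q ha hb 0 (j + 1) z = z := by
  suffices h : homX q a b 0 (j + 1) ∘ₗ homS q ha hb 0 (j + 1) +
      homY q a b 0 (j + 1) ∘ₗ homT q ha hb (j + 1) + homT q ha hb j ∘ₗ homY q a b 0 j +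
      homP q ha hb 0 (j + 1) = LinearMap.id from LinearMap.congr_fun h z
  refine monomial_ext q ha hb fun v u hv hu => ?_
  simp only [LinearMap.add_apply, LinearMap.comp_apply, LinearMap.id_apply]
  rw [homS_monomial q ha hb _ _ hu, homY_monomial, map_smul, homP_monomial,
    gap_of_even Even.zero]
  have hg := gap_add_gap_succ hb j
  rcases Nat.eq_zero_or_pos u with rfl | hu'
  · rw [if_neg (by omega), map_zero, zero_add, homT_monomial q ha hb _ hv, genDeg_zero, add_zero,
      pow_zero]
    by_cases h : gap b (j + 1) ≤ v
    · rw [if_pos ⟨rfl, h⟩, map_smul, homY_monomial, genDeg_zero, add_zero, pow_zero, smul_smul,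
        Nat.sub_add_cancel h, monomial_eq_zero q (by omega : b ≤ v + gap b j ∨ a ≤ 0), map_zero,
        smul_zero, add_zero]
      refine inv_mul_smul_add_ite _ _ _ ?_
      rw [scalarY_one_eq_zero_iff hb, Survives, ne_exceptional_iff_of_gap_le hv h]
      simp
    · rw [if_neg (fun h' => h h'.2), map_zero, zero_add, homT_monomial q ha hb _ (by omega),
        if_pos ⟨rfl, Nat.le_add_left _ _⟩, smul_smul, mul_comm, Nat.add_sub_cancel]
      refine inv_mul_smul_add_ite _ _ _ ?_
      rw [scalarY_one_eq_zero_iff hb, Survives, ne_exceptional_iff_of_lt_gap (by omega)]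
      simp
  · rw [if_pos (show 1 ≤ u from hu'), map_smul, homX_monomial, smul_smul, gap_of_even Even.zero,
      Nat.sub_add_cancel hu', homT_monomial_of_pos ha hb _ hu', map_zero, add_zero,
      homT_monomial_of_pos ha hb _ hu', smul_zero, add_zero]
    refine inv_mul_smul_add_ite _ _ _ ?_
    rw [scalarX_pow_eq_zero_iff q ha hq, Survives]
    have := genDeg_succ_pos hb j
    constructor <;> intro h
    · omega
    · omega

include hq in
theorem homX_homS_zero_zero (z : QuantumCI q a b) :
    homX q a b 0 0 (homS q ha hb 0 0 z) + homY q a b 0 0 (homT q ha hb 0 z) +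
      homP q ha hb 0 0 z = z := by
  suffices h : homX q a b 0 0 ∘ₗ homS q ha hb 0 0 + homY q a b 0 0 ∘ₗ homT q ha hb 0 +
      homP q ha hb 0 0 = LinearMap.id from LinearMap.congr_fun h z
  refine monomial_ext q ha hb fun v u hv hu => ?_
  simp only [LinearMap.add_apply, LinearMap.comp_apply, LinearMap.id_apply]
  rw [homS_monomial q ha hb _ _ hu, homP_monomial, gap_of_even Even.zero]
  rcases Nat.eq_zero_or_pos u with rfl | hu'
  · rw [if_neg (by omega), map_zero, zero_add, homT_monomial q ha hb _ hv,
      if_pos (show Survives k a b 0 0 v 0 from Or.inl rfl)]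
    split_ifs with h
    · rw [map_smul, homY_monomial, genDeg_zero, pow_zero, scalarY_one_of_even b Even.zero,
        zero_smul, smul_zero, zero_add]
    · rw [map_zero, zero_add]
  · rw [if_pos (show 1 ≤ u from hu'), map_smul, homX_monomial, smul_smul, gap_of_even Even.zero,
      Nat.sub_add_cancel hu', homT_monomial_of_pos ha hb _ hu', map_zero, add_zero]
    refine inv_mul_smul_add_ite _ _ _ ?_
    rw [scalarX_pow_eq_zero_iff q ha hq, Survives, genDeg_zero]
    simp [hu'.ne']

theorem homP_homP (i j : ℕ) (z : QuantumCI q a b) :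
    homP q ha hb i j (homP q ha hb i j z) = homP q ha hb i j z := by
  suffices h : homP q ha hb i j ∘ₗ homP q ha hb i j = homP q ha hb i j from
    LinearMap.congr_fun h z
  refine monomial_ext q ha hb fun v u hv hu => ?_
  rw [LinearMap.comp_apply, homP_monomial]
  split_ifs with h
  · rw [homP_monomial, if_pos h]
  · rw [map_zero]

end

variable (ha : 2 ≤ a) (hb : 2 ≤ b)

/-- A boundary has no surviving component: where the target could survive, either the scalar at `Q =
1` is zero or the shifted exponent reaches `a`. -/
theorem homP_homX (i j : ℕ) (z : QuantumCI q a b) :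
    homP q (by omega) (by omega) i j (homX q a b i j z) = 0 := by
  suffices h : homP q (by omega) (by omega) i j ∘ₗ homX q a b i j = 0 from LinearMap.congr_fun h z
  refine monomial_ext q (by omega) (by omega) fun v u hv hu => ?_
  rw [LinearMap.comp_apply, homX_monomial, map_smul, homP_monomial, LinearMap.zero_apply]
  have hg := gap_pos ha i
  split_ifs with h
  · rcases i with _ | i
    · rcases j with _ | j
      · obtain rfl : v = 0 := by rcases h with h | h <;> omega
        rw [genDeg_zero, pow_zero, scalarX_one_of_even a Even.zero, zero_smul]
      · have := h.1
        omega
    · obtain ⟨rfl, rfl, h⟩ := h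
      rw [genDeg_zero, pow_zero]
      by_cases hi : Even (i + 1)
      · rw [scalarX_one_of_even a hi, zero_smul]
      · rcases h with h | h
        · rw [exceptional_of_not_even hi] at h
          rw [gap_of_not_even hi] at h ⊢
          rw [monomial_eq_zero q (by omega), smul_zero]
        · rw [scalarX_one_of_not_even (by omega) hi, h, zero_smul]
  · rw [smul_zero]

theorem homP_homY (i j : ℕ) (z : QuantumCI q a b) :
    homP q (by omega) (by omega) i j (homY q a b i j z) = 0 := by
  suffices h : homP q (by omega) (by omega) i j ∘ₗ homY q a b i j = 0 from LinearMap.congr_fun h z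
  refine monomial_ext q (by omega) (by omega) fun v u hv hu => ?_
  rw [LinearMap.comp_apply, homY_monomial, map_smul, homP_monomial, LinearMap.zero_apply]
  have hg := gap_pos hb j
  split_ifs with h
  · rcases i with _ | i
    · rcases j with _ | j
      · obtain rfl : u = 0 := by rcases h with h | h <;> omega
        rw [genDeg_zero, pow_zero, scalarY_one_of_even b Even.zero, zero_smul]
      · obtain ⟨rfl, h⟩ := h
        rw [genDeg_zero, pow_zero]
        by_cases hj : Even (j + 1)
        · rw [scalarY_one_of_even b hj, zero_smul]
        · rcases h with h | h
          · rw [exceptional_of_not_even hj] at h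
            rw [gap_of_not_even hj] at h ⊢
            rw [monomial_eq_zero q (by omega), smul_zero]
          · rw [scalarY_one_of_not_even (by omega) hj, h, zero_smul]
    · have := h.2.1
      omega
  · rw [smul_zero]

theorem homX_homP (i j : ℕ) (z : QuantumCI q a b) :
    homX q a b i j (homP q (by omega) (by omega) (i + 1) j z) = 0 := by
  suffices h : homX q a b i j ∘ₗ homP q (by omega) (by omega) (i + 1) j = 0 from
    LinearMap.congr_fun h z
  refine monomial_ext q (by omega) (by omega) fun v u hv hu => ?_
  rw [LinearMap.comp_apply, homP_monomial, LinearMap.zero_apply]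
  split_ifs with h
  · obtain ⟨rfl, rfl, h⟩ := h
    rw [homX_monomial, genDeg_zero, pow_zero]
    by_cases hi : Even i
    · rw [scalarX_one_of_even a hi, zero_smul]
    · rcases h with h | h
      · rw [exceptional_of_even (by rwa [Nat.even_add_one])] at h
        rw [gap_of_not_even hi, monomial_eq_zero q (by omega), smul_zero]
      · rw [scalarX_one_of_not_even (by omega) hi, h, zero_smul]
  · rw [map_zero]

theorem homY_homP (i j : ℕ) (z : QuantumCI q a b) :
    homY q a b i j (homP q (by omega) (by omega) i (j + 1) z) = 0 := by
  suffices h : homY q a b i j ∘ₗ homP q (by omega) (by omega) i (j + 1) = 0 from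
    LinearMap.congr_fun h z
  refine monomial_ext q (by omega) (by omega) fun v u hv hu => ?_
  rw [LinearMap.comp_apply, homP_monomial, LinearMap.zero_apply]
  split_ifs with h
  · rcases i with _ | i
    · obtain ⟨rfl, h⟩ := h
      rw [homY_monomial, genDeg_zero, pow_zero]
      by_cases hj : Even j
      · rw [scalarY_one_of_even b hj, zero_smul]
      · rcases h with h | h
        · rw [exceptional_of_even (by rwa [Nat.even_add_one])] at h
          rw [gap_of_not_even hj, monomial_eq_zero q (by omega), smul_zero]
        · rw [scalarY_one_of_not_even (by omega) hj, h, zero_smul]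
    · exact absurd h.1 (Nat.succ_ne_zero j)
  · rw [map_zero]

end HochschildHomotopy

/-! ### The dimensions of the Hochschild homology -/

section Dimension

theorem totalDiff_apply {S M : Type*} [Ring S] [AddCommGroup M] [Module S M]
    (X Y : ℕ → ℕ → M →ₗ[S] M) (n : ℕ) (f : Idx (n + 1) → M) {i j : ℕ}
    (h : (i, j) ∈ Finset.HasAntidiagonal.antidiagonal n) :
    totalDiff X Y n f ⟨(i, j), h⟩ =
      X i j (f ⟨(i + 1, j), by simp at h ⊢; omega⟩) +
        (-1 : ℤ) ^ i • Y i j (f ⟨(i, j + 1), by simp at h ⊢; omega⟩) := by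
  have h' : i + j = n := by simpa using h
  change X i j (extendIdx S M (n + 1) f (i + 1) j) +
    (-1 : ℤ) ^ i • Y i j (extendIdx S M (n + 1) f i (j + 1)) = _
  rw [extendIdx_of_eq f (by omega), extendIdx_of_eq f (by omega)]

open scoped Classical in
/-- The rank of a map that is diagonal with entries `0` and `1` with respect to a basis. -/
theorem rank_range_of_basis {k V ι : Type*} [Field k] [AddCommGroup V] [Module k V] [Fintype ι]
    (B : Module.Basis ι k V) (φ : V →ₗ[k] V) (p : ι → Prop)
    (h : ∀ x, φ (B x) = if p x then B x else 0) :
    Module.rank k (LinearMap.range φ) = (Nat.card {x // p x} : Cardinal) := by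
  have hspan : LinearMap.range φ = Submodule.span k (Set.range fun x : {x // p x} => B x) := by
    rw [LinearMap.range_eq_map, ← B.span_eq, Submodule.map_span, ← Set.range_comp]
    apply le_antisymm
    · rw [Submodule.span_le]
      rintro _ ⟨x, rfl⟩
      rw [Function.comp_apply, h]
      split_ifs with hx
      · exact Submodule.subset_span ⟨⟨x, hx⟩, rfl⟩
      · exact Submodule.zero_mem _
    · refine Submodule.span_mono ?_
      rintro _ ⟨⟨x, hx⟩, rfl⟩
      exact ⟨x, by rw [Function.comp_apply, h, if_pos hx]⟩
  have hli : LinearIndependent k fun x : {x // p x} => B x :=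
    B.linearIndependent.comp _ Subtype.val_injective
  have := Module.Finite.of_basis B
  rw [hspan, ← Module.finrank_eq_rank, finrank_span_eq_card hli, Nat.card_eq_fintype_card]

variable {k : Type u} [Field k] {q : k} {a b : ℕ}

/-- The set of basis elements of the degree `n` part of the Hochschild complex that survive. -/
abbrev Survivor (k : Type u) [Field k] (a b n : ℕ) : Type :=
  {x : Σ _ : Idx n, Fin b × Fin a // Survives k a b x.1.1.1 x.1.1.2 x.2.1 x.2.2}

theorem rank_range_diagIdx_homP (ha : 0 < a) (hb : 0 < b) (n : ℕ) :
    Module.rank k (LinearMap.range (diagIdx (homP q ha hb) n)) =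
      (Nat.card (Survivor k a b n) : Cardinal) := by
  classical
  refine rank_range_of_basis (Pi.basis fun _ : Idx n => monomialBasis q ha hb) _ _ fun x => ?_
  obtain ⟨p, x⟩ := x
  ext p'
  rw [diagIdx_apply, Pi.basis_apply]
  by_cases hp : p' = p
  · subst hp
    rw [Pi.single_eq_same, monomialBasis_apply, homP_monomial]
    split_ifs
    · rw [Pi.single_eq_same]
    · rfl
  · rw [Pi.single_eq_of_ne hp, map_zero]
    split_ifs
    · rw [Pi.single_eq_of_ne hp]
    · rfl

/-- Right multiplication by a coefficient `c` becomes the right action of `c` on `A`, since `z · (x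
c) = (z · x) · c`. -/
theorem totalDiff_op_smul (n : ℕ) (z : QuantumCI q a b)
    (r : Idx (n + 1) → Enveloping k (QuantumCI q a b)) :
    letI := rightEnvelopingModule k (QuantumCI q a b)
    totalDiff (homX q a b) (homY q a b) n (fun p => op (r p) • z) =
      fun p => op (resDiff q a b n r p) • z := by
  let := rightEnvelopingModule k (QuantumCI q a b)
  ext ⟨⟨i, j⟩, h⟩
  have hX (x : Enveloping k (QuantumCI q a b)) :
      homX q a b i j (op x • z) = op (resX q a b i j x) • z := by
    change op (coeffX q a b i j) • op x • z = op (x * coeffX q a b i j) • z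
    rw [op_mul, mul_smul]
  have hY (x : Enveloping k (QuantumCI q a b)) :
      homY q a b i j (op x • z) = op (resY q a b i j x) • z := by
    change op (coeffY q a b i j) • op x • z = op (x * coeffY q a b i j) • z
    rw [op_mul, mul_smul]
  rw [resDiff, totalDiff_apply, totalDiff_apply, hX, hY, MulOpposite.op_add, add_smul]
  rcases neg_one_pow_eq_or ℤ i with h | h
  · rw [h, one_smul, one_smul]
  · rw [h, neg_smul, one_smul, neg_smul, one_smul, MulOpposite.op_neg, neg_smul]

variable (hq0 : q ≠ 0) (hq : ∀ m : ℕ, 0 < m → q ^ m ≠ 1) (ha : 2 ≤ a) (hb : 2 ≤ b)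

/-- The augmentation of the bimodule resolution, as a map of left modules. -/
def augmentationHom (q : k) (a b : ℕ) :
    letI := leftEnvelopingModule k (QuantumCI q a b)
    (Idx 0 → Enveloping k (QuantumCI q a b)) →ₗ[Enveloping k (QuantumCI q a b)]
      ModuleCat.of (Enveloping k (QuantumCI q a b)) (QuantumCI q a b) :=
  letI := leftEnvelopingModule k (QuantumCI q a b)
  LinearMap.toSpanSingleton (Enveloping k (QuantumCI q a b)) (QuantumCI q a b) 1 ∘ₗ
    LinearMap.proj idxZero

theorem augmentationHom_surjective (q : k) (a b : ℕ) :
    letI := leftEnvelopingModule k (QuantumCI q a b)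
    Function.Surjective (augmentationHom q a b) := fun x => by
  obtain ⟨z, hz⟩ := augmentation_surjective q a b x
  exact ⟨fun _ => z, hz⟩

include hq0 hq ha hb in
theorem rank_hochschildHomology_succ (n : ℕ) :
    Module.rank k (hochschildHomology k (QuantumCI q a b) (n + 1)) =
      (Nat.card (Survivor k a b (n + 1)) : Cardinal) := by
  have ha' : 0 < a := by omega
  have hb' : 0 < b := by omega
  let := leftEnvelopingModule k (QuantumCI q a b)
  let := rightEnvelopingModule k (QuantumCI q a b)
  have := rightEnvelopingModule_isScalarTower k (QuantumCI q a b)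
  rw [← rank_range_diagIdx_homP (q := q) ha' hb']
  refine rank_tor_succ k (QuantumCI q a b) (resDiff q a b) (resDiff_exact hq0 ha' hb')
    (ModuleCat.of _ (QuantumCI q a b)) (augmentationHom q a b) (augmentationHom_surjective q a b)
    (resDiff_exact_augmentation hq0 ha' hb') (totalDiff (homX q a b) (homY q a b))
    totalDiff_op_smul n (totalHtpy (homS q ha' hb') (homT q ha' hb') (n + 1))
    (totalHtpy (homS q ha' hb') (homT q ha' hb') n) (diagIdx (homP q ha' hb') (n + 1)) ?_ ?_ ?_ ?_
  · exact totalDiff_totalHtpy (homX q a b) (homY q a b) (homS q ha' hb') (homT q ha' hb')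
      (homP q ha' hb') (homX_homS hq ha' hb') (homY_homS ha' hb') (homX_homS_zero hq ha' hb')
      (homT_homX ha' hb') (homX_homS_zero_zero hq ha' hb') n
  · intro f
    ext p
    rw [diagIdx_apply, diagIdx_apply, homP_homP]
  · intro f
    ext ⟨⟨i, j⟩, h⟩
    rw [diagIdx_apply, totalDiff_apply, map_add, map_zsmul, homP_homX ha hb, homP_homY ha hb]
    simp
  · intro f
    ext ⟨⟨i, j⟩, h⟩
    rw [totalDiff_apply, diagIdx_apply, diagIdx_apply, homX_homP ha hb, homY_homP ha hb]
    simp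

include hq0 hq ha hb in
theorem rank_hochschildHomology_zero :
    Module.rank k (hochschildHomology k (QuantumCI q a b) 0) =
      (Nat.card (Survivor k a b 0) : Cardinal) := by
  have ha' : 0 < a := by omega
  have hb' : 0 < b := by omega
  let := leftEnvelopingModule k (QuantumCI q a b)
  let := rightEnvelopingModule k (QuantumCI q a b)
  have := rightEnvelopingModule_isScalarTower k (QuantumCI q a b)
  rw [← rank_range_diagIdx_homP (q := q) ha' hb']
  refine rank_tor_zero k (QuantumCI q a b) (resDiff q a b) (resDiff_exact hq0 ha' hb')
    (ModuleCat.of _ (QuantumCI q a b)) (augmentationHom q a b) (augmentationHom_surjective q a b)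
    (resDiff_exact_augmentation hq0 ha' hb') (totalDiff (homX q a b) (homY q a b))
    totalDiff_op_smul (totalHtpy (homS q ha' hb') (homT q ha' hb') 0)
    (diagIdx (homP q ha' hb') 0) ?_ ?_ ?_
  · exact totalDiff_totalHtpy_zero (homX q a b) (homY q a b) (homS q ha' hb') (homT q ha' hb')
      (homP q ha' hb') (homX_homS hq ha' hb') (homY_homS ha' hb') (homX_homS_zero hq ha' hb')
      (homT_homX ha' hb') (homX_homS_zero_zero hq ha' hb')
  · intro f
    ext p
    rw [diagIdx_apply, diagIdx_apply, homP_homP]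
  · intro f
    ext ⟨⟨i, j⟩, h⟩
    rw [diagIdx_apply, totalDiff_apply, map_add, map_zsmul, homP_homX ha hb, homP_homY ha hb]
    simp

theorem card_ne_or {a : ℕ} {e : ℕ} (he : e < a) (p : Prop) [Decidable p] :
    Nat.card {u : Fin a // (u : ℕ) ≠ e ∨ p} = if p then a else a - 1 := by
  split_ifs with h
  · rw [Nat.card_congr (Equiv.subtypeUnivEquiv fun _ => Or.inr h), Nat.card_fin]
  · have (u : Fin a) : ((u : ℕ) ≠ e ∨ p) ↔ ¬ u = ⟨e, he⟩ := by simp [h, Fin.ext_iff]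
    rw [Nat.card_congr (Equiv.subtypeEquivRight this), Nat.card_eq_fintype_card,
      Fintype.card_subtype_compl, Fintype.card_subtype_eq, Fintype.card_fin]

theorem exceptional_lt (ha : 0 < a) (i : ℕ) : exceptional a i < a := by
  rw [exceptional]
  split_ifs <;> omega

-- In positive degree only the end positions `(n + 1, 0)` and `(0, n + 1)` carry survivors, and
-- these are distinct.
include ha hb in
open scoped Classical in
theorem card_survivor_succ (n : ℕ) : Nat.card (Survivor k a b (n + 1)) =
    (if (a : k) = 0 then a else a - 1) + if (b : k) = 0 then b else b - 1 := by
  rw [← card_ne_or (exceptional_lt (by omega : 0 < a) (n + 1)),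
    ← card_ne_or (exceptional_lt (by omega : 0 < b) (n + 1)), ← Nat.card_sum]
  symm
  let f : {u : Fin a // (u : ℕ) ≠ exceptional a (n + 1) ∨ (a : k) = 0} ⊕
      {v : Fin b // (v : ℕ) ≠ exceptional b (n + 1) ∨ (b : k) = 0} → Survivor k a b (n + 1) :=
    Sum.elim (fun u => ⟨⟨⟨(n + 1, 0), by simp⟩, (⟨0, by omega⟩, u.1)⟩, rfl, rfl, u.2⟩)
      (fun v => ⟨⟨⟨(0, n + 1), by simp⟩, (v.1, ⟨0, by omega⟩)⟩, rfl, v.2⟩)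
  refine Nat.card_congr (Equiv.ofBijective f ⟨?_, ?_⟩)
  · rintro (⟨u, hu⟩ | ⟨v, hv⟩) (⟨u', hu'⟩ | ⟨v', hv'⟩) h
    · obtain rfl : u = u' := congrArg (fun x : Survivor k a b (n + 1) => x.1.2.2) h
      rfl
    · exact absurd (congrArg (fun x : Survivor k a b (n + 1) => x.1.1.1.1) h) (Nat.succ_ne_zero n)
    · exact absurd (congrArg (fun x : Survivor k a b (n + 1) => x.1.1.1.2) h) (Nat.succ_ne_zero n)
    · obtain rfl : v = v' := congrArg (fun x : Survivor k a b (n + 1) => x.1.2.1) h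
      rfl
  · rintro ⟨⟨⟨⟨i, j⟩, hij⟩, ⟨⟨v, hv⟩, ⟨u, hu⟩⟩⟩, h⟩
    rw [Finset.HasAntidiagonal.mem_antidiagonal] at hij
    dsimp only at hij
    rcases i with _ | i
    · rcases j with _ | j
      · omega
      · obtain rfl : j = n := by omega
        obtain ⟨h₁, h₂⟩ := h
        dsimp only at h₁
        subst h₁
        exact ⟨Sum.inr ⟨⟨v, hv⟩, h₂⟩, rfl⟩
    · obtain ⟨h₁, h₂, h₃⟩ := h
      dsimp only at h₁ h₂
      subst h₁ h₂
      obtain rfl : i = n := by omega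
      exact ⟨Sum.inl ⟨⟨u, hu⟩, h₃⟩, rfl⟩

include ha hb in
theorem card_survivor_zero : Nat.card (Survivor k a b 0) = a + b - 1 := by
  -- The shared class `1` is counted with the powers of `X`, so only `v ≠ 0` remains here; the
  -- disjunct `False` makes `card_ne_or` applicable.
  have h : Nat.card {v : Fin b // (v : ℕ) ≠ 0 ∨ False} = b - 1 :=
    (card_ne_or (by omega) False).trans (if_neg id)
  rw [Nat.add_sub_assoc (by omega), ← h, ← Nat.card_fin a, ← Nat.card_sum]
  symm
  let f : Fin a ⊕ {v : Fin b // (v : ℕ) ≠ 0 ∨ False} → Survivor k a b 0 :=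
    Sum.elim (fun u => ⟨⟨⟨(0, 0), by simp⟩, (⟨0, by omega⟩, u)⟩, Or.inr rfl⟩)
      (fun v => ⟨⟨⟨(0, 0), by simp⟩, (v.1, ⟨0, by omega⟩)⟩, Or.inl rfl⟩)
  rw [Nat.card_fin]
  refine Nat.card_congr (Equiv.ofBijective f ⟨?_, ?_⟩)
  · rintro (u | ⟨v, hv⟩) (u' | ⟨v', hv'⟩) h
    · exact congrArg Sum.inl (congrArg (fun x : Survivor k a b 0 => x.1.2.2) h)
    · exact absurd (congrArg (fun x : Survivor k a b 0 => (x.1.2.1 : ℕ)) h).symm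
        (hv'.resolve_right id)
    · exact absurd (congrArg (fun x : Survivor k a b 0 => (x.1.2.1 : ℕ)) h) (hv.resolve_right id)
    · obtain rfl : v = v' := congrArg (fun x : Survivor k a b 0 => x.1.2.1) h
      rfl
  · rintro ⟨⟨⟨⟨i, j⟩, hij⟩, ⟨⟨v, hv⟩, ⟨u, hu⟩⟩⟩, h⟩
    obtain ⟨rfl, rfl⟩ : i = 0 ∧ j = 0 := by simpa using hij
    change u = 0 ∨ v = 0 at h
    by_cases hv0 : v = 0
    · subst hv0
      exact ⟨Sum.inl ⟨u, hu⟩, rfl⟩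
    · obtain rfl : u = 0 := by omega
      exact ⟨Sum.inr ⟨⟨v, hv⟩, Or.inl hv0⟩, rfl⟩

end Dimension

end HochschildQCI

end

/-! ### The main theorem -/

theorem theorem3p1 {k : Type u} [Field k] (q : k) (hq0 : q ≠ 0)
    (hq : ∀ m : ℕ, 0 < m → q ^ m ≠ 1) (a b : ℕ) (ha : 2 ≤ a) (hb : 2 ≤ b) :
    Module.rank k (HochschildQCI.hochschildHomology k (HochschildQCI.QuantumCI q a b) 0) =
        ((a + b - 1 : ℕ) : Cardinal) ∧
    (∀ n : ℕ, 1 ≤ n →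
      ((ringChar k ∣ a ∧ ringChar k ∣ b) →
        Module.rank k (HochschildQCI.hochschildHomology k (HochschildQCI.QuantumCI q a b) n) =
          ((a + b : ℕ) : Cardinal)) ∧
      ((ringChar k ∣ a ∧ ¬ ringChar k ∣ b) ∨ (¬ ringChar k ∣ a ∧ ringChar k ∣ b) →
        Module.rank k (HochschildQCI.hochschildHomology k (HochschildQCI.QuantumCI q a b) n) =
          ((a + b - 1 : ℕ) : Cardinal)) ∧
      ((¬ ringChar k ∣ a ∧ ¬ ringChar k ∣ b) →
        Module.rank k (HochschildQCI.hochschildHomology k (HochschildQCI.QuantumCI q a b) n) =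
          ((a + b - 2 : ℕ) : Cardinal))) ∧
    (∀ n : ℕ, Nontrivial
      (HochschildQCI.hochschildHomology k (HochschildQCI.QuantumCI q a b) n)) := by
  have hsucc (m : ℕ) := (HochschildQCI.rank_hochschildHomology_succ hq0 hq ha hb m).trans
    (congrArg _ (HochschildQCI.card_survivor_succ (k := k) ha hb m))
  have hzero := (HochschildQCI.rank_hochschildHomology_zero hq0 hq ha hb).trans
    (congrArg _ (HochschildQCI.card_survivor_zero (k := k) ha hb))
  -- The vanishing of `a` and `b` in `k` becomes divisibility by the characteristic.
  simp only [ringChar.spec] at hsucc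
  refine ⟨hzero, fun n hn => ?_, fun n => ?_⟩
  · obtain ⟨m, rfl⟩ := Nat.exists_eq_add_of_le' hn
    rw [hsucc]
    refine ⟨fun h => ?_, fun h => ?_, fun h => ?_⟩
    · rw [if_pos h.1, if_pos h.2]
    · rcases h with h | h
      · rw [if_pos h.1, if_neg h.2, Nat.add_sub_assoc (by omega)]
      · rw [if_neg h.1, if_pos h.2, Nat.sub_add_comm (by omega)]
    · rw [if_neg h.1, if_neg h.2]
      congr 1
      omega
  · rw [← rank_pos_iff_nontrivial (R := k)]
    rcases n with _ | m
    · rw [hzero, Nat.cast_pos]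
      omega
    · rw [hsucc, Nat.cast_pos]
      split_ifs <;> omega
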